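/- Consider an $S$-stage implicit Runge--Kutta (RK) method with real coefficient matrix $A=(a_{ij})$, weights $b=(b_i)$ and nodes $c_i\in[0,1]$. Suppose that it has order $p$ and stage order $q\le p-1$: for every smooth system $y'=F(t,y)$, one step of size $h$ from an exact solution has local error $O(h^{p+1})$, and every internal stage value has error $O(h^{q+1})$, as $h\to0+$. Suppose that all eigenvalues of $A$ have positive real parts and that the method is L-stable: its stability function $r(z)=1+z\,b^{T}(I-zA)^{-1}\mathbf 1$ satisfies $|r(z)|\le1$ for $\operatorname{Re}z\le0$ and $r(z)\to0$ as $|z|\to\infty$. For $s\in\mathbb C$ put $Y_s(T)=\int_0^Te^{-s(T-\tau)}g(\tau)\,d\tau$, the solution of $Y'=-sY+g$, $Y(0)=0$. (a) For $\operatorname{Re}s\ge0$ and every $h>0$, each RK step for $Y'=-sY+g$ is uniquely defined. (b) For all $t>0$ and $\sigma$ there is a constant $C\ge 0$, depending only on the method, $p$, $t$ and $\sigma$, such that the following holds. Let $0\le t_0<t$, $T=t-t_0$, $Nh=T$ with $h>0$ and $N\in\mathbb N$, and $g\in C^{\gamma}([0,T];\mathbb C)$ with an integer $\gamma\ge p$.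 Let $s_1,\dots,s_P\in\mathbb C$ satisfy $\operatorname{Re}s_\ell\ge0$, $|s_\ell|\le\sigma$ and $|s_\ell h|\le1$. Let $Y_\ell^N$ be the value after $N$ RK steps of size $h$ for $Y'=-s_\ell Y+g$, $Y(0)=0$. Then $$\max_{\ell}\bigl|Y_{s_\ell}(T)-Y_\ell^N\bigr|\le C\,h^{p}\Bigl(\sum_{k=0}^{p-1}|g^{(k)}(0)|+\max_{0\le\tau\le T}|g^{(p)}(\tau)|\Bigr).$$ (c) Let $t>0$, let $f:(0,t]\to\mathbb C$ be integrable with the asymptotic expansion $f(\tau)\sim a_0\tau^{-\alpha}+a_1\tau+a_2\tau^2+\cdots$ as $\tau\to0+$, where $0\le\alpha<1$, that is, $f(\tau)-f_K(\tau)=o(\tau^K)$ for all $K\ge0$ with $f_K(\tau)=a_0\tau^{-\alpha}+\sum_{k=1}^{K}a_k\tau^k$. Let $g\in C^\gamma([0,t];\mathbb C)$ with an integer $\gamma\ge p$, let $L\le\gamma$ and $M\ge0$ be integers, and let $\kappa,\sigma,W$ be real. Then there is a constant $C\ge 0$, depending only on these data and on the method and $p$, such that the following holds. Let $h>0$, $0\le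 t_0<t$, $t_0\le\kappa h$ and $Nh=T:=t-t_0$ with $N\in\mathbb N$. Let $G$ be the polynomial of degree less than $L$ that interpolates $g$ at $L$ distinct points of $[t-t_0,t]$. Let $f_{\rm es}(x)=\sum_{\ell=1}^{P}m_\ell e^{-s_\ell x}$ with $\sum_\ell|m_\ell|\le W$, $\operatorname{Re}s_\ell\ge0$, $|s_\ell|\le\sigma$ and $|s_\ell h|\le1$ satisfy $|f-f_{\rm es}|\le\varepsilon$ on $(t_0,t]$. Let $Y_\ell^N$ be as in (b). Then $y(t)=\int_0^tf(t-\tau)g(\tau)\,d\tau$ and its approximation $$y_h(t)=\int_0^{t_0}f_M(\tau)\,G(t-\tau)\,d\tau+\sum_{\ell=1}^{P}m_\ell e^{-s_\ell t_0}Y_\ell^N$$ satisfy $$|y(t)-y_h(t)|\le C\bigl(h^{\min\{M+1,\,L,\,p\}}+\varepsilon\bigr).$$ -/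

import Mathlib

open Filter Topology Asymptotics
open scoped ContDiff

/-- The Butcher tableau of an `S`-stage Runge–Kutta method: the coefficients `a_{ij}`, the
weights `b_i` and the nodes `c_i`. -/
structure RKTableau (S : ℕ) where
  A : Matrix (Fin S) (Fin S) ℝ
  b : Fin S → ℝ
  c : Fin S → ℝ

namespace RKTableau

variable {S : ℕ} {E : Type*} [NormedAddCommGroup E] [NormedSpace ℝ E]

/-- `K` is a family of stage derivatives of one Runge–Kutta step of size `h` from `(t, y)` for
`y' = F(t, y)`: `K_i = F(t + c_i h, y + h ∑_j a_{ij} K_j)`. -/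
def IsStages (R : RKTableau S) (F : ℝ → E → E) (t h : ℝ) (y : E) (K : Fin S → E) : Prop :=
  ∀ i, K i = F (t + R.c i * h) (y + h • ∑ j, R.A i j • K j)

/-- `y₁` is the result of one Runge–Kutta step of size `h` from `(t, y)` for `y' = F(t, y)`. -/
def IsStep (R : RKTableau S) (F : ℝ → E → E) (t h : ℝ) (y y₁ : E) : Prop :=
  ∃ K : Fin S → E, R.IsStages F t h y K ∧ y₁ = y + h • ∑ i, R.b i • K i

/-- Local data at `t₀`: a smooth equation `y' = F(t, y)`, a solution `y` near `t₀`, and stage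
derivatives `K h` of the Runge–Kutta step from `(t₀, y t₀)` for all small `h > 0`, on the branch
that tends to `F(t₀, y(t₀))` as `h → 0`. -/
structure IsLocalRun (R : RKTableau S) (F : ℝ → E → E) (y : ℝ → E) (t₀ : ℝ)
    (K : ℝ → Fin S → E) : Prop where
  smooth : ContDiff ℝ ∞ (fun x : ℝ × E => F x.1 x.2)
  solution : ∀ᶠ t in 𝓝 t₀, HasDerivAt y (F t (y t)) t
  stages : ∀ᶠ h in 𝓝[>] (0 : ℝ), R.IsStages F t₀ h (y t₀) (K h)
  branch : ∀ i, Tendsto (fun h => K h i) (𝓝[>] 0) (𝓝 (F t₀ (y t₀)))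

/-- The method has order (at least) `p`: for every smooth system of ordinary differential
equations the local truncation error is `O(h^{p+1})`. -/
def HasOrder (R : RKTableau S) (p : ℕ) : Prop :=
  ∀ (d : ℕ) (F : ℝ → EuclideanSpace ℝ (Fin d) → EuclideanSpace ℝ (Fin d))
    (y : ℝ → EuclideanSpace ℝ (Fin d)) (t₀ : ℝ) (K : ℝ → Fin S → EuclideanSpace ℝ (Fin d)),
    R.IsLocalRun F y t₀ K →
      (fun h : ℝ => y (t₀ + h) - (y t₀ + h • ∑ i, R.b i • K h i))
        =O[𝓝[>] 0] (fun h : ℝ => h ^ (p + 1))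

/-- The method has stage order (at least) `q`: for every smooth system of ordinary differential
equations the error of each internal stage value is `O(h^{q+1})`. -/
def HasStageOrder (R : RKTableau S) (q : ℕ) : Prop :=
  ∀ (d : ℕ) (F : ℝ → EuclideanSpace ℝ (Fin d) → EuclideanSpace ℝ (Fin d))
    (y : ℝ → EuclideanSpace ℝ (Fin d)) (t₀ : ℝ) (K : ℝ → Fin S → EuclideanSpace ℝ (Fin d)),
    R.IsLocalRun F y t₀ K →
      ∀ i, (fun h : ℝ => y (t₀ + R.c i * h) - (y t₀ + h • ∑ j, R.A i j • K h j))
        =O[𝓝[>] 0] (fun h : ℝ => h ^ (q + 1))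

/-- The coefficient matrix, with complex entries. -/
noncomputable def AC (R : RKTableau S) : Matrix (Fin S) (Fin S) ℂ :=
  R.A.map (fun x : ℝ => (x : ℂ))

/-- The stability function `r(z) = 1 + z βᵀ (I - z A)⁻¹ E`, with `E` the vector of ones. -/
noncomputable def stab (R : RKTableau S) (z : ℂ) : ℂ :=
  1 + z * ((fun i => (R.b i : ℂ)) ⬝ᵥ ((1 - z • R.AC)⁻¹.mulVec (fun _ => 1)))

/-- L-stability: `|r(z)| ≤ 1` for `Re z ≤ 0`, and `r(∞) = 0`. -/
def LStable (R : RKTableau S) : Prop :=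
  (∀ z : ℂ, z.re ≤ 0 → ‖R.stab z‖ ≤ 1) ∧ Tendsto R.stab (cocompact ℂ) (𝓝 0)

/-- All eigenvalues of the coefficient matrix have positive real parts. -/
def EigenvaluesPos (R : RKTableau S) : Prop :=
  ∀ μ ∈ spectrum ℂ R.AC, 0 < μ.re

/-- `Y 0, …, Y N` is the Runge–Kutta solution, with step size `h`, of `Y' = -s Y + g`,
`Y(0) = 0`. -/
def IsSolution (R : RKTableau S) (s : ℂ) (g : ℝ → ℂ) (h : ℝ) (N : ℕ) (Y : ℕ → ℂ) : Prop :=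
  Y 0 = 0 ∧ ∀ n < N, R.IsStep (fun τ u => -s * u + g τ) (n * h) h (Y n) (Y (n + 1))

end RKTableau

/-- The solution at time `T` of `Y' = -s Y + g`, `Y(0) = 0`:
`Y(T) = ∫₀ᵀ e^{-s (T - τ)} g(τ) dτ`. -/
noncomputable def expConv (s : ℂ) (g : ℝ → ℂ) (T : ℝ) : ℂ :=
  ∫ τ in (0 : ℝ)..T, Complex.exp (-s * ((T - τ : ℝ) : ℂ)) * g τ

/-- The maximum over `ℓ` of the errors at time `T` of the final values `Y ℓ N` for the `P`
equations `Y' = -s_ℓ Y + g` (zero if `P = 0`). -/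
noncomputable def maxRKError {P : ℕ} (s : Fin P → ℂ) (g : ℝ → ℂ) (T : ℝ) (N : ℕ)
    (Y : Fin P → ℕ → ℂ) : ℝ :=
  ⨆ ℓ, ‖expConv (s ℓ) g T - Y ℓ N‖

/-- `∑_{k<p} |g^{(k)}(0)| + max_{0 ≤ τ ≤ T} |g^{(p)}(τ)|`, derivatives on `[0, T]`. -/
noncomputable def dataNorm (g : ℝ → ℂ) (p : ℕ) (T : ℝ) : ℝ :=
  ∑ k ∈ Finset.range p, ‖iteratedDerivWithin k g (Set.Icc 0 T) 0‖
    + sSup ((fun τ => ‖iteratedDerivWithin p g (Set.Icc 0 T) τ‖) '' Set.Icc 0 T)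

/-- The convolution `y(t) = ∫₀ᵗ f(t - τ) g(τ) dτ`. -/
noncomputable def convInt (f g : ℝ → ℂ) (t : ℝ) : ℂ :=
  ∫ τ in (0 : ℝ)..t, f (t - τ) * g τ

/-- The sum of exponentials `∑_ℓ m_ℓ e^{-s_ℓ x}`. -/
noncomputable def soe {P : ℕ} (m s : Fin P → ℂ) (x : ℝ) : ℂ :=
  ∑ ℓ, m ℓ * Complex.exp (-s ℓ * (x : ℂ))

/-- The generalized Taylor series truncated at order `M`:
`f_M(τ) = a₀ τ^{-α} + a₁ τ + ⋯ + a_M τ^M`. -/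
noncomputable def genTaylor (a : ℕ → ℂ) (α : ℝ) (M : ℕ) (τ : ℝ) : ℂ :=
  a 0 * ((τ ^ (-α) : ℝ) : ℂ) + ∑ k ∈ Finset.Icc 1 M, a k * (τ : ℂ) ^ k

/-- `f(τ) ∼ a₀ τ^{-α} + a₁ τ + a₂ τ² + ⋯` as `τ → 0+`, as an asymptotic expansion: the error of
the truncation at each order `M` is `o(τ^M)`. A series that converges to `f` near `0` is a special
case. -/
def HasGenTaylor (f : ℝ → ℂ) (a : ℕ → ℂ) (α : ℝ) : Prop :=
  ∀ M : ℕ, (fun τ : ℝ => f τ - genTaylor a α M τ) =o[𝓝[>] 0] (fun τ : ℝ => τ ^ M)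

/-- The interpolation polynomial of `g`, of degree less than `L`, at the nodes `x 0, …, x (L-1)`. -/
noncomputable def interp {L : ℕ} (x : Fin L → ℝ) (g : ℝ → ℂ) : Polynomial ℂ :=
  Lagrange.interpolate Finset.univ (fun i => (x i : ℂ)) (fun i => g (x i))

/-- The approximation of the singular part `I₁ = ∫₀^{t₀} f(τ) g(t - τ) dτ`, in which `f` is
replaced by its truncated generalized Taylor series and `g` by the polynomial `G`. -/
noncomputable def singularApprox (a : ℕ → ℂ) (α : ℝ) (M : ℕ) (G : Polynomial ℂ) (t t₀ : ℝ) : ℂ :=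
  ∫ τ in (0 : ℝ)..t₀, genTaylor a α M τ * G.eval ((t - τ : ℝ) : ℂ)

/-- The approximation of the regular part `I₂ = ∫₀ᵀ f(t - τ) g(τ) dτ`, `T = t - t₀`: in
`∑_ℓ m_ℓ ∫₀ᵀ e^{-s_ℓ (t - τ)} g(τ) dτ = ∑_ℓ m_ℓ e^{-s_ℓ t₀} Y_ℓ(T)` each `Y_ℓ(T)` is replaced by
the Runge–Kutta value `Y ℓ N`. -/
noncomputable def regularApprox {P : ℕ} (m s : Fin P → ℂ) (t₀ : ℝ) (N : ℕ)
    (Y : Fin P → ℕ → ℂ) : ℂ :=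
  ∑ ℓ, m ℓ * Complex.exp (-s ℓ * (t₀ : ℂ)) * Y ℓ N

/-! ### Order conditions -/

/-! Put `z = -s * h`. One Runge–Kutta step sends `u` to `r(z) u + h bᵀ(I - zA)⁻¹ g(τ + c h)`; the
exact flow sends it to `e^z u + h ∫₀¹ e^{z(1-x)} g(τ + x h) dx`. Everything rests on comparing `∫₀¹
e^{z(1-x)} x^l dx` with `bᵀ(I - zA)⁻¹ c^l`. Their coefficients of `z^k` are `l!/(l+k+1)!` and `bᵀ
A^k c^l`, and these agree for `k + l + 1 ≤ p`: they are the order conditions for linear equations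
(`HasOrder.order_condition`).

Hence the defect for `x^l` is `O(|z|^{p-l})`, uniformly on the half disc `Re z ≤ 0`, `|z| ≤ 1`,
where the resolvent is bounded (`HasOrder.exists_quadDefect_pow_bound`). Since `|z| ≤ σ h` and the
Taylor term of `g(τ + x h)` in `x^l` carries `h^l`, each step commits an error `O(h^{p+1})`. As
`|r(z)| ≤ 1`, the `N = T/h` local errors simply add up to `O(h^p)` (`HasOrder.exists_error_bound`).

For the convolution, split the integral at `t₀ = O(h)`. Near the singularity, `∫₀^{t₀} |f - f_M| =
O(t₀^{M+1})` and interpolation costs `O(t₀^L)`. Away from it, replacing `f` by exponentials costs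
`O(ε)`, and the Runge–Kutta errors enter with total weight at most `W`. -/

theorem eq_zero_of_const_mul_pow_isBigO {c : ℝ} {n m : ℕ} (hnm : n < m)
    (h : (fun x : ℝ => c * x ^ n) =O[𝓝[>] 0] (fun x : ℝ => x ^ m)) : c = 0 := by
  obtain ⟨k, rfl⟩ := Nat.exists_eq_add_of_lt hnm
  have h1 : (fun _ : ℝ => c) =O[𝓝[>] (0 : ℝ)] (fun x : ℝ => x ^ (k + 1)) := by
    obtain ⟨C, hC⟩ := h.bound
    refine IsBigO.of_bound C ?_
    filter_upwards [hC, self_mem_nhdsWithin] with x hx hx0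
    have hx0 : 0 < x := hx0
    have hpos : 0 < ‖x ^ n‖ := norm_pos_iff.2 (pow_pos hx0 n).ne'
    rw [norm_mul, add_assoc, pow_add, norm_mul] at hx
    refine le_of_mul_le_mul_right ?_ hpos
    linarith
  have h2 : Tendsto (fun x : ℝ => x ^ (k + 1)) (𝓝[>] 0) (𝓝 0) := by
    have := (continuous_pow (M := ℝ) (k + 1)).tendsto 0
    rw [zero_pow (Nat.succ_ne_zero k)] at this
    exact this.mono_left nhdsWithin_le_nhds
  exact tendsto_nhds_unique tendsto_const_nhds (h1.trans_tendsto h2)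

theorem hasDerivAt_toLp {d : ℕ} {y : ℝ → Fin d → ℝ} {y' : Fin d → ℝ} {t : ℝ}
    (h : ∀ i, HasDerivAt (fun t => y t i) (y' i) t) :
    HasDerivAt (fun t => (WithLp.toLp 2 (y t) : EuclideanSpace ℝ (Fin d)))
      (WithLp.toLp 2 y') t :=
  (EuclideanSpace.equiv (Fin d) ℝ).symm.hasFDerivAt.comp_hasDerivAt t (hasDerivAt_pi.2 h)

namespace RKTableau

variable {S : ℕ}

/-- The chain `y₀' = t^l`, `y_{j+1}' = y_j`. -/
noncomputable def chainField (k l : ℕ) (t : ℝ) (y : EuclideanSpace ℝ (Fin (k + 1))) :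
    EuclideanSpace ℝ (Fin (k + 1)) :=
  WithLp.toLp 2 (Fin.cons (t ^ l) fun j : Fin k => y j.castSucc)

/-- The solution of the chain with zero initial values. -/
noncomputable def chainSol (k l : ℕ) (t : ℝ) : EuclideanSpace ℝ (Fin (k + 1)) :=
  WithLp.toLp 2 fun j => (l.factorial : ℝ) / ((l + j + 1).factorial : ℝ) * t ^ (l + j + 1)

/-- The stage derivatives of one Runge–Kutta step for the chain. -/
noncomputable def chainStages (R : RKTableau S) (k l : ℕ) (h : ℝ) (i : Fin S) :
    EuclideanSpace ℝ (Fin (k + 1)) :=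
  WithLp.toLp 2 fun j => h ^ (l + j : ℕ) * (R.A ^ (j : ℕ)).mulVec (fun i => R.c i ^ l) i

/-- The chain is triangular: component `j + 1` of the stages is `h A` applied to component `j`. The
stages are therefore explicit for every `A`, and powers of `A` appear. -/
theorem isLocalRun_chain (R : RKTableau S) (k l : ℕ) :
    R.IsLocalRun (chainField k l) (chainSol k l) 0 (R.chainStages k l) where
  smooth := by
    refine contDiff_euclidean.2 fun i => ?_
    refine Fin.cases ?_ (fun j => ?_) i
    · simp only [chainField, Fin.cons_zero]
      fun_prop
    · simp only [chainField, Fin.cons_succ]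
      fun_prop
  solution := by
    refine Eventually.of_forall fun t => hasDerivAt_toLp fun i => ?_
    have key : ∀ n : ℕ, HasDerivAt
        (fun t : ℝ => (l.factorial : ℝ) / ((l + n + 1).factorial : ℝ) * t ^ (l + n + 1))
        ((l.factorial : ℝ) / ((l + n).factorial : ℝ) * t ^ (l + n)) t := by
      intro n
      refine ((hasDerivAt_pow (l + n + 1) t).const_mul _).congr_deriv ?_
      rw [Nat.factorial_succ]
      have := Nat.factorial_ne_zero (l + n)
      push_cast
      field_simp
    refine Fin.cases ?_ (fun j => ?_) i
    · have := key 0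
      simpa [Nat.factorial_ne_zero] using this
    · have := key (j + 1)
      simpa [chainSol, add_assoc] using this
  stages := by
    refine Eventually.of_forall fun h i => ?_
    ext j
    refine Fin.cases ?_ (fun j => ?_) j
    · simp [chainStages, chainField, mul_pow, mul_comm]
    · simp only [chainStages, chainField, chainSol, Fin.cons_succ, PiLp.add_apply,
        PiLp.smul_apply, WithLp.ofLp_sum, Finset.sum_apply, smul_eq_mul, Fin.val_succ,
        Fin.val_castSucc, WithLp.ofLp_smul, Pi.smul_apply]
      rw [pow_succ' R.A, ← Matrix.mulVec_mulVec, zero_pow (Nat.succ_ne_zero _), mul_zero, zero_add]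
      simp only [Matrix.mulVec, dotProduct, Finset.mul_sum]
      refine Finset.sum_congr rfl fun m _ => Finset.sum_congr rfl fun n _ => ?_
      ring
  branch := by
    intro i
    refine ((PiLp.continuous_toLp 2 _).tendsto _).comp (tendsto_pi_nhds.2 fun j => ?_)
    have hc : Tendsto (fun h : ℝ => h ^ (l + j : ℕ) *
        (R.A ^ (j : ℕ)).mulVec (fun i => R.c i ^ l) i) (𝓝[>] 0)
        (𝓝 (0 ^ (l + j : ℕ) * (R.A ^ (j : ℕ)).mulVec (fun i => R.c i ^ l) i)) :=
      (Continuous.tendsto (by fun_prop) 0).mono_left nhdsWithin_le_nhds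
    convert hc using 2
    refine Fin.cases ?_ (fun j => ?_) j
    -- For `l = 0` the first component is the constant `1 = 0 ^ 0`; otherwise it tends to `0`.
    · rcases l with _ | l <;> simp
    · simp [chainSol]

/-- In the last component of the chain both the exact and the numerical value are multiples of
`h^{l+k+1}`. Their difference is `O(h^{p+1})` with `l + k + 1 < p + 1`, so the coefficients
coincide. -/
theorem HasOrder.order_condition {R : RKTableau S} {p : ℕ} (hR : R.HasOrder p) {k l : ℕ}
    (hkl : k + l + 1 ≤ p) :
    R.b ⬝ᵥ (R.A ^ k).mulVec (fun i => R.c i ^ l) =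
      (l.factorial : ℝ) / ((l + k + 1).factorial : ℝ) := by
  have h := hR _ _ _ 0 _ (R.isLocalRun_chain k l)
  have h1 := ((EuclideanSpace.proj (𝕜 := ℝ) (Fin.last k)).isBigO_comp _ (𝓝[>] 0)).trans h
  refine (sub_eq_zero.1 (eq_zero_of_const_mul_pow_isBigO (n := l + k + 1) (m := p + 1)
    (by omega) (h1.congr_left fun x => ?_))).symm
  simp only [chainStages, chainSol, PiLp.proj_apply, PiLp.add_apply, PiLp.sub_apply,
        PiLp.smul_apply, WithLp.ofLp_sum, Finset.sum_apply, smul_eq_mul, Fin.val_last,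
        WithLp.ofLp_smul, Pi.smul_apply, zero_add]
  rw [zero_pow (Nat.succ_ne_zero _), mul_zero, zero_add, sub_mul, dotProduct, Finset.sum_mul,
    Finset.mul_sum]
  congr 1
  refine Finset.sum_congr rfl fun i _ => ?_
  ring

theorem HasOrder.order_condition_complex {R : RKTableau S} {p : ℕ} (hR : R.HasOrder p) {k l : ℕ}
    (hkl : k + l + 1 ≤ p) :
    (fun i => (R.b i : ℂ)) ⬝ᵥ (R.AC ^ k).mulVec (fun i => (R.c i : ℂ) ^ l) =
      (l.factorial : ℂ) / ((l + k + 1).factorial : ℂ) := by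
  have h := congrArg Complex.ofRealHom (hR.order_condition hkl)
  rw [RingHom.map_dotProduct] at h
  have hA : R.AC ^ k = (R.A ^ k).map Complex.ofRealHom := by
    rw [Matrix.map_pow]; rfl
  have hv : (fun i => (R.c i : ℂ) ^ l) = Complex.ofRealHom ∘ fun i => R.c i ^ l := by
    ext i; simp
  have hm : (R.AC ^ k).mulVec (fun i => (R.c i : ℂ) ^ l) =
      Complex.ofRealHom ∘ (R.A ^ k).mulVec (fun i => R.c i ^ l) := by
    ext i
    rw [hA, hv, Function.comp_apply, RingHom.map_mulVec]
  rw [hm]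
  simpa [Function.comp_def] using h

end RKTableau

/-! ### Solvability of the stage equations and rational weights -/

namespace RKTableau

variable {S : ℕ}

/-- If `I - zA` were singular, `z⁻¹` would be an eigenvalue of `A`; but `Re z⁻¹` has the sign of `Re
z`. -/
theorem EigenvaluesPos.isUnit {R : RKTableau S} (hR : R.EigenvaluesPos) {z : ℂ} (hz : z.re ≤ 0) :
    IsUnit (1 - z • R.AC) := by
  by_cases h0 : z = 0
  · simp [h0]
  by_contra hu
  have hmem : z⁻¹ ∈ spectrum ℂ R.AC := by
    rw [spectrum.mem_iff]
    intro h
    apply hu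
    have e : 1 - z • R.AC = (Units.mk0 z h0) • (algebraMap ℂ _ z⁻¹ - R.AC) := by
      rw [Units.smul_mk0, smul_sub, Algebra.algebraMap_eq_smul_one, smul_smul, mul_inv_cancel₀ h0,
        one_smul]
    rw [e]
    exact (IsUnit.smul _ h)
  have := hR _ hmem
  rw [Complex.inv_re] at this
  have h2 : z.re / Complex.normSq z ≤ 0 := div_nonpos_of_nonpos_of_nonneg hz (Complex.normSq_nonneg _)
  linarith

theorem EigenvaluesPos.inv_mul_cancel {R : RKTableau S} (hR : R.EigenvaluesPos) {z : ℂ}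
    (hz : z.re ≤ 0) : (1 - z • R.AC)⁻¹ * (1 - z • R.AC) = 1 :=
  Matrix.nonsing_inv_mul _ ((Matrix.isUnit_iff_isUnit_det _).1 (hR.isUnit hz))

theorem EigenvaluesPos.mul_inv_cancel {R : RKTableau S} (hR : R.EigenvaluesPos) {z : ℂ}
    (hz : z.re ≤ 0) : (1 - z • R.AC) * (1 - z • R.AC)⁻¹ = 1 :=
  Matrix.mul_nonsing_inv _ ((Matrix.isUnit_iff_isUnit_det _).1 (hR.isUnit hz))

/-- The functional `v ↦ bᵀ (I - z A)⁻¹ v`. -/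
noncomputable def wt (R : RKTableau S) (z : ℂ) (v : Fin S → ℂ) : ℂ :=
  (fun i => (R.b i : ℂ)) ⬝ᵥ ((1 - z • R.AC)⁻¹.mulVec v)

theorem stab_eq (R : RKTableau S) (z : ℂ) : R.stab z = 1 + z * R.wt z (fun _ => 1) := rfl

theorem wt_add (R : RKTableau S) (z : ℂ) (v w : Fin S → ℂ) :
    R.wt z (v + w) = R.wt z v + R.wt z w := by
  simp [wt, Matrix.mulVec_add]

theorem wt_smul (R : RKTableau S) (z : ℂ) (a : ℂ) (v : Fin S → ℂ) :
    R.wt z (a • v) = a * R.wt z v := by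
  simp [wt, Matrix.mulVec_smul]

theorem wt_sum (R : RKTableau S) (z : ℂ) {ι : Type*} (s : Finset ι) (v : ι → Fin S → ℂ) :
    R.wt z (∑ i ∈ s, v i) = ∑ i ∈ s, R.wt z (v i) := by
  classical
  induction s using Finset.induction_on with
  | empty => simp [wt]
  | insert a s ha ih => rw [Finset.sum_insert ha, Finset.sum_insert ha, wt_add, ih]

theorem EigenvaluesPos.wt_recursion {R : RKTableau S} (hR : R.EigenvaluesPos) {z : ℂ}
    (hz : z.re ≤ 0) (v : Fin S → ℂ) :
    R.wt z v = (fun i => (R.b i : ℂ)) ⬝ᵥ v + z * R.wt z (R.AC.mulVec v) := by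
  have h : (1 - z • R.AC)⁻¹ = 1 + z • ((1 - z • R.AC)⁻¹ * R.AC) := by
    have := hR.inv_mul_cancel hz
    rw [mul_sub, mul_one, mul_smul_comm, sub_eq_iff_eq_add] at this
    exact this
  have h2 : (1 - z • R.AC)⁻¹.mulVec v =
      v + z • (1 - z • R.AC)⁻¹.mulVec (R.AC.mulVec v) := by
    conv_lhs => rw [h]
    rw [Matrix.add_mulVec, Matrix.one_mulVec, Matrix.smul_mulVec, Matrix.mulVec_mulVec]
  rw [wt, h2, dotProduct_add, dotProduct_smul, smul_eq_mul, wt]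

/-- Neumann series with exact remainder, the discrete counterpart of `expPhi_expansion`. -/
theorem EigenvaluesPos.wt_expansion {R : RKTableau S} (hR : R.EigenvaluesPos) {z : ℂ}
    (hz : z.re ≤ 0) (v : Fin S → ℂ) (m : ℕ) :
    R.wt z v = ∑ k ∈ Finset.range m, z ^ k * ((fun i => (R.b i : ℂ)) ⬝ᵥ (R.AC ^ k).mulVec v)
      + z ^ m * R.wt z ((R.AC ^ m).mulVec v) := by
  induction m with
  | zero => simp
  | succ m ih =>
    rw [ih, Finset.sum_range_succ, hR.wt_recursion hz ((R.AC ^ m).mulVec v), Matrix.mulVec_mulVec,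
      ← pow_succ']
    ring

/-- The weights are bounded on the closed left half of the unit disc. -/
theorem EigenvaluesPos.exists_wt_bound {R : RKTableau S} (hR : R.EigenvaluesPos) :
    ∃ B : ℝ, 0 ≤ B ∧ ∀ z : ℂ, z.re ≤ 0 → ‖z‖ ≤ 1 → ∀ (v : Fin S → ℂ) (K : ℝ),
      (∀ i, ‖v i‖ ≤ K) → ‖R.wt z v‖ ≤ B * K := by
  have hK : IsCompact {z : ℂ | z.re ≤ 0 ∧ ‖z‖ ≤ 1} := by
    have : {z : ℂ | z.re ≤ 0 ∧ ‖z‖ ≤ 1} = Metric.closedBall 0 1 ∩ {z : ℂ | z.re ≤ 0} := by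
      ext z; simp [and_comm]
    rw [this]
    exact (isCompact_closedBall _ _).inter_right
      (isClosed_le Complex.continuous_re continuous_const)
  have hcont : ∀ j : Fin S, ContinuousOn (fun z => R.wt z (Pi.single j 1))
      {z : ℂ | z.re ≤ 0 ∧ ‖z‖ ≤ 1} := by
    intro j z hz
    refine ContinuousAt.continuousWithinAt ?_
    have h1 : ContinuousAt (fun z : ℂ => (1 - z • R.AC)⁻¹) z := by
      refine ContinuousAt.comp (f := fun z : ℂ => 1 - z • R.AC) (g := Inv.inv)
        (continuousAt_matrix_inv _ ?_) (Continuous.continuousAt (by fun_prop))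
      rw [Ring.inverse_eq_inv']
      exact continuousAt_inv₀ ((Matrix.isUnit_iff_isUnit_det _).1 (hR.isUnit hz.1)).ne_zero
    have h2 : Continuous (fun X : Matrix (Fin S) (Fin S) ℂ =>
        (fun i => (R.b i : ℂ)) ⬝ᵥ (X.mulVec (Pi.single j 1))) := by fun_prop
    exact h2.continuousAt.comp h1
  have hb : ∀ j : Fin S, ∃ B : ℝ, 0 ≤ B ∧ ∀ z : ℂ, z.re ≤ 0 → ‖z‖ ≤ 1 →
      ‖R.wt z (Pi.single j 1)‖ ≤ B := by
    intro j
    obtain ⟨B, hB⟩ := hK.exists_bound_of_continuousOn (hcont j)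
    exact ⟨max B 0, le_max_right _ _, fun z hz hz1 => (hB z ⟨hz, hz1⟩).trans (le_max_left _ _)⟩
  choose B hB0 hB using hb
  -- By linearity in `v`, uniformity over all `v` reduces to the finitely many basis vectors, each
  -- giving a continuous function on a compact set.
  refine ⟨∑ j, B j, Finset.sum_nonneg fun j _ => hB0 j, fun z hz hz1 v K hv => ?_⟩
  have hsum : R.wt z v = ∑ j, v j * R.wt z (Pi.single j 1) := by
    have : v = ∑ j, v j • (Pi.single j 1 : Fin S → ℂ) := by
      ext i; simp [Finset.sum_apply, Pi.single_apply]
    conv_lhs => rw [this]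
    rw [wt_sum]
    simp only [wt_smul]
  rw [hsum, Finset.sum_mul]
  refine (norm_sum_le _ _).trans (Finset.sum_le_sum fun j _ => ?_)
  rw [norm_mul, mul_comm]
  exact mul_le_mul (hB j z hz hz1) (hv j) (norm_nonneg _) (hB0 j)

/-- For this linear equation the stage equations read `(I - zA) K = v` and have exactly one
solution; this closed form of the step gives unique solvability and drives the error recursion. -/
theorem EigenvaluesPos.isStep_iff {R : RKTableau S} (hR : R.EigenvaluesPos) {s : ℂ} {g : ℝ → ℂ}
    {τ h : ℝ} (hz : (-s * h).re ≤ 0) {u u₁ : ℂ} :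
    R.IsStep (fun τ u => -s * u + g τ) τ h u u₁ ↔
      u₁ = R.stab (-s * h) * u + h * R.wt (-s * h) (fun i => g (τ + R.c i * h)) := by
  set z : ℂ := -s * h with hzdef
  set v : Fin S → ℂ := (-s * u) • (fun _ => 1) + fun i => g (τ + R.c i * h) with hv
  have hst : ∀ K : Fin S → ℂ, R.IsStages (fun τ u => -s * u + g τ) τ h u K ↔
      (1 - z • R.AC).mulVec K = v := by
    intro K
    rw [IsStages, funext_iff]
    refine forall_congr' fun i => ?_
    rw [Matrix.sub_mulVec, Matrix.one_mulVec, Matrix.smul_mulVec, Pi.sub_apply, Pi.smul_apply,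
      sub_eq_iff_eq_add]
    have : R.AC.mulVec K i = ∑ j, R.A i j • K j := by
      simp [Matrix.mulVec, dotProduct, AC]
    rw [this]
    simp only [hv, Pi.add_apply, Pi.smul_apply, smul_eq_mul, mul_one, hzdef, Complex.real_smul]
    constructor <;> intro h <;> rw [h] <;> ring
  have hsol : ∀ K : Fin S → ℂ, (1 - z • R.AC).mulVec K = v ↔ K = (1 - z • R.AC)⁻¹.mulVec v := by
    intro K
    constructor
    · rintro h
      rw [← h, Matrix.mulVec_mulVec, hR.inv_mul_cancel hz, Matrix.one_mulVec]
    · rintro rfl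
      rw [Matrix.mulVec_mulVec, hR.mul_inv_cancel hz, Matrix.one_mulVec]
  have hval : u + h • ∑ i, R.b i • ((1 - z • R.AC)⁻¹.mulVec v) i =
      R.stab z * u + h * R.wt z (fun i => g (τ + R.c i * h)) := by
    have : ∑ i, R.b i • ((1 - z • R.AC)⁻¹.mulVec v) i = R.wt z v := by
      simp [wt, dotProduct]
    rw [this, hv, wt_add, wt_smul, stab_eq, Complex.real_smul, hzdef]
    ring
  constructor
  · rintro ⟨K, hK, rfl⟩
    rw [hst, hsol] at hK
    rw [hK, hval]
  · rintro rfl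
    exact ⟨_, (hst _).2 ((hsol _).2 rfl), hval.symm⟩

end RKTableau

/-! ### The functions `φ_l` -/

/-- `φ_l(z) = ∫₀¹ e^{z (1 - x)} x^l / l! dx`. -/
noncomputable def expPhi (l : ℕ) (z : ℂ) : ℂ :=
  ∫ x in (0 : ℝ)..1, Complex.exp (z * (1 - (x : ℂ))) * ((x : ℂ) ^ l / (l.factorial : ℂ))

theorem hasDerivAt_exp_mul_one_sub (z : ℂ) (x : ℝ) :
    HasDerivAt (fun x : ℝ => Complex.exp (z * (1 - (x : ℂ))))
      (-z * Complex.exp (z * (1 - (x : ℂ)))) x := by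
  have h : HasDerivAt (fun x : ℝ => z * (1 - (x : ℂ))) (z * (0 - 1)) x :=
    ((hasDerivAt_const x (1 : ℂ)).sub Complex.ofRealCLM.hasDerivAt).const_mul z
  refine h.cexp.congr_deriv ?_
  ring

/-- Integration by parts, raising `x^l / l!` to its primitive. -/
theorem expPhi_recursion (l : ℕ) (z : ℂ) :
    expPhi l z = 1 / ((l + 1).factorial : ℂ) + z * expPhi (l + 1) z := by
  have hv : ∀ x : ℝ, HasDerivAt (fun x : ℝ => (x : ℂ) ^ (l + 1) / ((l + 1).factorial : ℂ))
      ((x : ℂ) ^ l / (l.factorial : ℂ)) x := by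
    intro x
    have h : HasDerivAt (fun x : ℝ => (x : ℂ)) 1 x := Complex.ofRealCLM.hasDerivAt
    refine ((h.fun_pow (l + 1)).div_const _).congr_deriv ?_
    rw [Nat.factorial_succ]
    have h1 : (l.factorial : ℂ) ≠ 0 := Nat.cast_ne_zero.2 (Nat.factorial_ne_zero l)
    have h2 : (l : ℂ) + 1 ≠ 0 := Nat.cast_add_one_ne_zero l
    push_cast
    field_simp
  have h := intervalIntegral.integral_mul_deriv_eq_deriv_mul (a := 0) (b := 1)
    (fun x _ => hasDerivAt_exp_mul_one_sub z x) (fun x _ => hv x)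
    (Continuous.intervalIntegrable (by fun_prop) _ _)
    (Continuous.intervalIntegrable (by fun_prop) _ _)
  rw [expPhi, h, expPhi, ← intervalIntegral.integral_const_mul]
  simp only [mul_assoc, neg_mul, intervalIntegral.integral_neg]
  simp

theorem expPhi_expansion (l m : ℕ) (z : ℂ) :
    expPhi l z = ∑ k ∈ Finset.range m, z ^ k * (1 / ((l + k + 1).factorial : ℂ))
      + z ^ m * expPhi (l + m) z := by
  induction m with
  | zero => simp
  | succ m ih =>
    rw [ih, Finset.sum_range_succ, expPhi_recursion (l + m)]
    rw [show l + (m + 1) = l + m + 1 from rfl]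
    ring

theorem exp_eq_one_add_mul_expPhi (z : ℂ) : Complex.exp z = 1 + z * expPhi 0 z := by
  have h := intervalIntegral.integral_eq_sub_of_hasDerivAt (a := 0) (b := 1)
    (fun x _ => hasDerivAt_exp_mul_one_sub z x) (Continuous.intervalIntegrable (by fun_prop) _ _)
  rw [intervalIntegral.integral_const_mul] at h
  have h2 : expPhi 0 z = ∫ x in (0 : ℝ)..1, Complex.exp (z * (1 - (x : ℂ))) := by
    simp [expPhi]
  rw [h2]
  simp only [Complex.ofReal_one, Complex.ofReal_zero, sub_self, sub_zero, mul_zero, mul_one,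
    Complex.exp_zero] at h
  linear_combination h

theorem norm_cexp_le_one {w : ℂ} (hw : w.re ≤ 0) : ‖Complex.exp w‖ ≤ 1 := by
  rw [Complex.norm_exp]
  exact Real.exp_le_one_iff.2 hw

theorem norm_integral_exp_mul_le {z : ℂ} (hz : z.re ≤ 0) {u : ℝ → ℂ} {K : ℝ}
    (hu : ∀ x ∈ Set.Icc (0 : ℝ) 1, ‖u x‖ ≤ K) :
    ‖∫ x in (0 : ℝ)..1, Complex.exp (z * (1 - (x : ℂ))) * u x‖ ≤ K := by
  have h := intervalIntegral.norm_integral_le_of_norm_le_const (a := 0) (b := 1) (C := K)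
    (f := fun x : ℝ => Complex.exp (z * (1 - (x : ℂ))) * u x) ?_
  · simpa using h
  · intro x hx
    rw [Set.uIoc_of_le zero_le_one] at hx
    have h1 : ‖Complex.exp (z * (1 - (x : ℂ)))‖ ≤ 1 := by
      apply norm_cexp_le_one
      rw [← Complex.ofReal_one, ← Complex.ofReal_sub, Complex.re_mul_ofReal]
      exact mul_nonpos_of_nonpos_of_nonneg hz (by linarith [hx.2])
    have h2 := hu x ⟨hx.1.le, hx.2⟩
    rw [norm_mul]
    calc _ ≤ 1 * ‖u x‖ := by gcongr
      _ ≤ K := by linarith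

theorem norm_expPhi_le_one (l : ℕ) {z : ℂ} (hz : z.re ≤ 0) : ‖expPhi l z‖ ≤ 1 := by
  refine norm_integral_exp_mul_le hz fun x hx => ?_
  rw [norm_div, norm_pow, Complex.norm_real, Real.norm_of_nonneg hx.1, Complex.norm_natCast]
  have h1 : (1 : ℝ) ≤ l.factorial := by exact_mod_cast Nat.one_le_iff_ne_zero.2 (Nat.factorial_ne_zero l)
  exact div_le_one_of_le₀ ((pow_le_one₀ hx.1 hx.2).trans h1) (by linarith)

namespace RKTableau

variable {S : ℕ}

/-! ### The quadrature defect of one step -/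

/-- The defect `∫₀¹ e^{z (1 - x)} u(x) dx - bᵀ (I - z A)⁻¹ u(c)` of one step. -/
noncomputable def quadDefect (R : RKTableau S) (z : ℂ) (u : ℝ → ℂ) : ℂ :=
  (∫ x in (0 : ℝ)..1, Complex.exp (z * (1 - (x : ℂ))) * u x) - R.wt z (fun i => u (R.c i))

/-- The error of the propagator is `z` times the defect of the constant function, hence one order
smaller than that defect. -/
theorem exp_sub_stab (R : RKTableau S) (z : ℂ) :
    Complex.exp z - R.stab z = z * R.quadDefect z (fun x => (x : ℂ) ^ 0) := by
  rw [exp_eq_one_add_mul_expPhi, stab_eq, quadDefect, expPhi]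
  simp
  ring

theorem intervalIntegrable_exp_mul (z : ℂ) {u : ℝ → ℂ} (hu : ContinuousOn u (Set.Icc 0 1)) :
    IntervalIntegrable (fun x : ℝ => Complex.exp (z * (1 - (x : ℂ))) * u x)
      MeasureTheory.volume 0 1 := by
  apply ContinuousOn.intervalIntegrable
  rw [Set.uIcc_of_le zero_le_one]
  exact ContinuousOn.mul (by fun_prop) hu

theorem quadDefect_add (R : RKTableau S) (z : ℂ) {u v : ℝ → ℂ}
    (hu : ContinuousOn u (Set.Icc 0 1)) (hv : ContinuousOn v (Set.Icc 0 1)) :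
    R.quadDefect z (fun x => u x + v x) = R.quadDefect z u + R.quadDefect z v := by
  simp only [quadDefect, mul_add]
  rw [intervalIntegral.integral_add (intervalIntegrable_exp_mul z hu)
    (intervalIntegrable_exp_mul z hv)]
  have := R.wt_add z (fun i => u (R.c i)) (fun i => v (R.c i))
  simp only [Pi.add_def] at this
  rw [this]
  ring

theorem quadDefect_sum_pow (R : RKTableau S) (z : ℂ) (m : ℕ) (a : ℕ → ℂ) :
    R.quadDefect z (fun x => ∑ k ∈ Finset.range m, a k * (x : ℂ) ^ k) =
      ∑ k ∈ Finset.range m, a k * R.quadDefect z (fun x => (x : ℂ) ^ k) := by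
  induction m with
  | zero =>
    have : R.wt z (fun _ => 0) = 0 := by
      have h := R.wt_smul z 0 (fun _ => 0)
      rw [zero_smul, zero_mul] at h
      exact h
    simp [quadDefect, this]
  | succ m ih =>
    simp only [Finset.sum_range_succ]
    rw [quadDefect_add R z (by fun_prop) (by fun_prop), ih]
    congr 1
    simp only [quadDefect, mul_sub]
    rw [← intervalIntegral.integral_const_mul, ← wt_smul]
    congr 1
    congr 1
    ext x
    ring

theorem EigenvaluesPos.exists_quadDefect_bound {R : RKTableau S} (hR : R.EigenvaluesPos)
    (hc : ∀ i, R.c i ∈ Set.Icc (0 : ℝ) 1) :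
    ∃ B : ℝ, 0 ≤ B ∧ ∀ z : ℂ, z.re ≤ 0 → ‖z‖ ≤ 1 → ∀ (u : ℝ → ℂ) (K : ℝ),
      (∀ x ∈ Set.Icc (0 : ℝ) 1, ‖u x‖ ≤ K) → ‖R.quadDefect z u‖ ≤ B * K := by
  obtain ⟨B, hB0, hB⟩ := hR.exists_wt_bound
  refine ⟨1 + B, by linarith, fun z hz hz1 u K hu => ?_⟩
  refine (norm_sub_le _ _).trans ?_
  rw [add_mul, one_mul]
  exact add_le_add (norm_integral_exp_mul_le hz hu) (hB z hz hz1 _ K fun i => hu _ (hc i))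

theorem HasOrder.exists_quadDefect_pow_bound {R : RKTableau S} {p : ℕ} (hp : R.HasOrder p)
    (hR : R.EigenvaluesPos) :
    ∃ C : ℝ, 0 ≤ C ∧ ∀ l < p, ∀ z : ℂ, z.re ≤ 0 → ‖z‖ ≤ 1 →
      ‖R.quadDefect z (fun x => (x : ℂ) ^ l)‖ ≤ C * ‖z‖ ^ (p - l) := by
  obtain ⟨B, hB0, hB⟩ := hR.exists_wt_bound
  set K : ℕ → ℝ := fun l =>
    (l.factorial : ℝ) + B * ‖(R.AC ^ (p - l)).mulVec (fun i => (R.c i : ℂ) ^ l)‖ with hKdef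
  have hK0 : ∀ l, 0 ≤ K l := fun l => by positivity
  refine ⟨∑ l ∈ Finset.range p, K l, Finset.sum_nonneg fun l _ => hK0 l,
    fun l hl z hz hz1 => ?_⟩
  have hfac : (l.factorial : ℂ) ≠ 0 := Nat.cast_ne_zero.2 (Nat.factorial_ne_zero l)
  have hint : (∫ x in (0 : ℝ)..1, Complex.exp (z * (1 - (x : ℂ))) * (x : ℂ) ^ l) =
      l.factorial * expPhi l z := by
    rw [expPhi, ← intervalIntegral.integral_const_mul]
    congr 1
    ext x
    field_simp
  -- Both expansions are cut at `z^(p - l)`; the order conditions cancel all lower terms and leave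
  -- only the two bounded remainders.
  have key : R.quadDefect z (fun x => (x : ℂ) ^ l) =
      z ^ (p - l) * (l.factorial * expPhi (l + (p - l)) z
        - R.wt z ((R.AC ^ (p - l)).mulVec (fun i => (R.c i : ℂ) ^ l))) := by
    rw [quadDefect, hint, expPhi_expansion l (p - l), hR.wt_expansion hz _ (p - l), mul_add,
      Finset.mul_sum]
    have : ∀ k ∈ Finset.range (p - l), (l.factorial : ℂ) * (z ^ k * (1 / ((l + k + 1).factorial : ℂ)))
        = z ^ k * ((fun i => (R.b i : ℂ)) ⬝ᵥ (R.AC ^ k).mulVec (fun i => (R.c i : ℂ) ^ l)) := by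
      intro k hk
      have := Finset.mem_range.1 hk
      rw [hp.order_condition_complex (by omega)]
      ring
    rw [Finset.sum_congr rfl this]
    ring
  rw [key, norm_mul, norm_pow, mul_comm]
  gcongr
  refine le_trans ?_ (Finset.single_le_sum (f := K) (fun l _ => hK0 l) (Finset.mem_range.2 hl))
  refine (norm_sub_le _ _).trans (add_le_add ?_ (hB z hz hz1 _ _ fun i => norm_le_pi_norm _ i))
  rw [norm_mul, Complex.norm_natCast]
  have := norm_expPhi_le_one (l + (p - l)) hz
  have h0 : (0 : ℝ) ≤ l.factorial := Nat.cast_nonneg _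
  nlinarith

end RKTableau

/-! ### Iterated derivatives on intervals -/

theorem iteratedDerivWithin_Icc_subset {E : Type*} [NormedAddCommGroup E] [NormedSpace ℝ E]
    {f : ℝ → E} {a b c d x : ℝ} {n k : ℕ} (hcd : c < d) (hs : Set.Icc c d ⊆ Set.Icc a b)
    (hf : ContDiffOn ℝ n f (Set.Icc a b)) (hk : k ≤ n) (hx : x ∈ Set.Icc c d) :
    iteratedDerivWithin k f (Set.Icc c d) x = iteratedDerivWithin k f (Set.Icc a b) x := by
  have hab : a < b :=
    (hs ⟨le_rfl, hcd.le⟩).1.trans_lt (hcd.trans_le (hs ⟨hcd.le, le_rfl⟩).2)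
  simp only [iteratedDerivWithin]
  rw [iteratedFDerivWithin_subset hs (uniqueDiffOn_Icc hcd) (uniqueDiffOn_Icc hab)
    (hf.of_le (by exact_mod_cast hk)) hx]

theorem hasDerivWithinAt_iteratedDerivWithin {E : Type*} [NormedAddCommGroup E]
    [NormedSpace ℝ E] {f : ℝ → E} {a b x : ℝ} {n k : ℕ} (hab : a < b)
    (hf : ContDiffOn ℝ n f (Set.Icc a b)) (hk : k < n) (hx : x ∈ Set.Icc a b) :
    HasDerivWithinAt (iteratedDerivWithin k f (Set.Icc a b))
      (iteratedDerivWithin (k + 1) f (Set.Icc a b) x) (Set.Icc a b) x := by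
  rw [iteratedDerivWithin_succ]
  exact (hf.differentiableOn_iteratedDerivWithin (by exact_mod_cast hk) (uniqueDiffOn_Icc hab) x
    hx).hasDerivWithinAt

theorem bddAbove_norm_iteratedDerivWithin {g : ℝ → ℂ} {p n : ℕ} {T : ℝ} (hT : 0 < T) (hpn : p ≤ n)
    (hg : ContDiffOn ℝ n g (Set.Icc 0 T)) :
    BddAbove ((fun τ => ‖iteratedDerivWithin p g (Set.Icc 0 T) τ‖) '' Set.Icc 0 T) :=
  isCompact_Icc.bddAbove_image
    (hg.continuousOn_iteratedDerivWithin (by exact_mod_cast hpn) (uniqueDiffOn_Icc hT)).norm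

theorem dataNorm_nonneg (g : ℝ → ℂ) (p : ℕ) (T : ℝ) : 0 ≤ dataNorm g p T := by
  refine add_nonneg (Finset.sum_nonneg fun _ _ => norm_nonneg _) (Real.sSup_nonneg ?_)
  rintro _ ⟨x, -, rfl⟩
  exact norm_nonneg _

/-- Descent from the `p`-th derivative: each lower one is its value at `0` plus at most `T` times
the bound on the next, which costs a factor `1 + T`. -/
theorem norm_iteratedDerivWithin_le_dataNorm {g : ℝ → ℂ} {p n : ℕ} {T : ℝ} (hT : 0 < T)
    (hpn : p ≤ n) (hg : ContDiffOn ℝ n g (Set.Icc 0 T)) (j : ℕ) :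
    ∀ k, k + j = p → ∀ x ∈ Set.Icc 0 T,
      ‖iteratedDerivWithin k g (Set.Icc 0 T) x‖ ≤ (1 + T) ^ j * dataNorm g p T := by
  have hsup0 : 0 ≤ sSup ((fun τ => ‖iteratedDerivWithin p g (Set.Icc 0 T) τ‖) '' Set.Icc 0 T) := by
    refine Real.sSup_nonneg ?_
    rintro _ ⟨x, -, rfl⟩
    exact norm_nonneg _
  induction j with
  | zero =>
    rintro k rfl x hx
    have h1 := le_csSup (bddAbove_norm_iteratedDerivWithin hT hpn hg) ⟨x, hx, rfl⟩
    have h2 : 0 ≤ ∑ k ∈ Finset.range k, ‖iteratedDerivWithin k g (Set.Icc 0 T) 0‖ :=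
      Finset.sum_nonneg fun _ _ => norm_nonneg _
    simp only [add_zero, pow_zero, one_mul, dataNorm] at h1 ⊢
    linarith
  | succ j ih =>
    intro k hk x hx
    have h0 : (0 : ℝ) ∈ Set.Icc 0 T := ⟨le_rfl, hT.le⟩
    have hD := dataNorm_nonneg g p T
    have hmv := (convex_Icc 0 T).norm_image_sub_le_of_norm_hasDerivWithin_le
      (fun y hy => hasDerivWithinAt_iteratedDerivWithin hT hg (show k < n by omega) hy)
      (ih (k + 1) (by omega)) h0 hx
    have hzero : ‖iteratedDerivWithin k g (Set.Icc 0 T) 0‖ ≤ dataNorm g p T := by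
      have := Finset.single_le_sum (f := fun k => ‖iteratedDerivWithin k g (Set.Icc 0 T) 0‖)
        (fun _ _ => norm_nonneg _) (Finset.mem_range.2 (show k < p by omega))
      simp only [dataNorm] at this ⊢
      linarith
    have hx' : ‖x - 0‖ ≤ T := by
      rw [sub_zero, Real.norm_of_nonneg hx.1]; exact hx.2
    have hp1 : 1 ≤ (1 + T) ^ j := one_le_pow₀ (by linarith)
    calc ‖iteratedDerivWithin k g (Set.Icc 0 T) x‖
        ≤ ‖iteratedDerivWithin k g (Set.Icc 0 T) 0‖
          + ‖iteratedDerivWithin k g (Set.Icc 0 T) x - iteratedDerivWithin k g (Set.Icc 0 T) 0‖ :=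
          norm_le_norm_add_norm_sub' _ _
      _ ≤ 1 * dataNorm g p T + (1 + T) ^ j * dataNorm g p T * T := by
          rw [one_mul]
          exact add_le_add hzero (hmv.trans (by gcongr))
      _ ≤ (1 + T) ^ j * dataNorm g p T + (1 + T) ^ j * dataNorm g p T * T := by gcongr
      _ = (1 + T) ^ (j + 1) * dataNorm g p T := by ring

/-! ### The exact solution -/

theorem norm_exp_neg_mul_le_one {s : ℂ} (hs : 0 ≤ s.re) {x : ℝ} (hx : 0 ≤ x) :
    ‖Complex.exp (-s * (x : ℂ))‖ ≤ 1 := by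
  apply norm_cexp_le_one
  rw [Complex.re_mul_ofReal, Complex.neg_re]
  nlinarith

theorem norm_expConv_le {s : ℂ} (hs : 0 ≤ s.re) {g : ℝ → ℂ} {T K : ℝ} (hT : 0 ≤ T)
    (hg : ∀ x ∈ Set.Icc 0 T, ‖g x‖ ≤ K) : ‖expConv s g T‖ ≤ K * T := by
  have h := intervalIntegral.norm_integral_le_of_norm_le_const (a := 0) (b := T) (C := K)
    (f := fun τ : ℝ => Complex.exp (-s * ((T - τ : ℝ) : ℂ)) * g τ) ?_
  · rwa [sub_zero, abs_of_nonneg hT] at h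
  · intro x hx
    rw [Set.uIoc_of_le hT] at hx
    have h1 := norm_exp_neg_mul_le_one hs (sub_nonneg.2 hx.2)
    have h2 := hg x ⟨hx.1.le, hx.2⟩
    rw [norm_mul]
    calc _ ≤ 1 * ‖g x‖ := by gcongr
      _ ≤ K := by linarith

/-- Variation of constants over one step, rescaled to `[0, 1]`. -/
theorem expConv_add {s : ℂ} {g : ℝ → ℂ} {a h : ℝ} (ha : 0 ≤ a) (hh : 0 < h)
    (hg : ContinuousOn g (Set.Icc 0 (a + h))) :
    expConv s g (a + h) = Complex.exp (-s * h) * expConv s g a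
      + h * ∫ x in (0 : ℝ)..1, Complex.exp (-s * h * (1 - (x : ℂ))) * g (a + x * h) := by
  have hint : ∀ c d : ℝ, 0 ≤ c → c ≤ d → d ≤ a + h → IntervalIntegrable
      (fun τ : ℝ => Complex.exp (-s * ((a + h - τ : ℝ) : ℂ)) * g τ) MeasureTheory.volume c d := by
    intro c d hc hcd hd
    apply ContinuousOn.intervalIntegrable
    rw [Set.uIcc_of_le hcd]
    exact ContinuousOn.mul (by fun_prop) (hg.mono (Set.Icc_subset_Icc hc hd))
  have hsplit := intervalIntegral.integral_add_adjacent_intervals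
    (hint 0 a le_rfl ha (by linarith)) (hint a (a + h) ha (by linarith) le_rfl)
  rw [expConv, ← hsplit]
  congr 1
  · rw [expConv, ← intervalIntegral.integral_const_mul]
    congr 1
    ext τ
    rw [← mul_assoc, ← Complex.exp_add]
    congr 2
    push_cast
    ring
  · have := intervalIntegral.smul_integral_comp_add_mul (a := 0) (b := 1)
      (fun τ : ℝ => Complex.exp (-s * ((a + h - τ : ℝ) : ℂ)) * g τ) h a
    rw [mul_zero, add_zero, mul_one, Complex.real_smul] at this
    rw [← this]
    congr 2
    ext x
    rw [mul_comm h x]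
    congr 2
    push_cast
    ring

namespace RKTableau

variable {S : ℕ}

/-! ### Local and global errors -/

theorem HasOrder.exists_quadDefect_smooth_bound {R : RKTableau S} {p : ℕ} (hp : R.HasOrder p)
    (hp1 : 1 ≤ p) (hR : R.EigenvaluesPos) (hc : ∀ i, R.c i ∈ Set.Icc (0 : ℝ) 1) (σ : ℝ) :
    ∃ C : ℝ, 0 ≤ C ∧ ∀ (g : ℝ → ℂ) (n : ℕ) (T a h K : ℝ) (z : ℂ), p ≤ n →
      ContDiffOn ℝ n g (Set.Icc 0 T) → 0 ≤ a → 0 < h → a + h ≤ T →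
      (∀ k ≤ p, ∀ x ∈ Set.Icc 0 T, ‖iteratedDerivWithin k g (Set.Icc 0 T) x‖ ≤ K) →
      z.re ≤ 0 → ‖z‖ ≤ 1 → ‖z‖ ≤ σ * h →
      ‖R.quadDefect z (fun x => g (a + x * h))‖ ≤ C * K * h ^ p := by
  obtain ⟨B, hB0, hB⟩ := hR.exists_quadDefect_bound hc
  obtain ⟨C, hC0, hC⟩ := hp.exists_quadDefect_pow_bound hR
  refine ⟨∑ k ∈ Finset.range p, C * |σ| ^ (p - k) + B, by positivity, ?_⟩
  intro g n T a h K z hpn hg ha hh haT hK hz hz1 hzσ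
  have hab : a < a + h := by linarith
  have hsub : Set.Icc a (a + h) ⊆ Set.Icc 0 T := Set.Icc_subset_Icc ha haT
  have ha' : a ∈ Set.Icc a (a + h) := ⟨le_rfl, hab.le⟩
  have hK0 : 0 ≤ K := (norm_nonneg _).trans (hK 0 (Nat.zero_le _) a (hsub ha'))
  -- Taylor polynomial of degree `m = p - 1`, so that the remainder involves the `p`-th derivative.
  obtain ⟨m, rfl⟩ : ∃ m, p = m + 1 := ⟨p - 1, by omega⟩
  have hgsub := hg.mono hsub
  have hx : ∀ x ∈ Set.Icc (0 : ℝ) 1, a + x * h ∈ Set.Icc a (a + h) := by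
    intro x hx
    constructor <;> nlinarith [hx.1, hx.2]
  set c : ℕ → ℂ := fun k =>
    ((k.factorial : ℂ))⁻¹ * (h : ℂ) ^ k * iteratedDerivWithin k g (Set.Icc 0 T) a with hcdef
  have htaylor : ∀ x ∈ Set.Icc (0 : ℝ) 1,
      ‖g (a + x * h) - ∑ k ∈ Finset.range (m + 1), c k * (x : ℂ) ^ k‖ ≤ K * h ^ (m + 1) := by
    intro x hx01
    have ht := taylor_mean_remainder_bound (n := m) (C := K) hab.le
      (hgsub.of_le (by exact_mod_cast hpn)) (hx x hx01) (fun y hy => by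
        rw [iteratedDerivWithin_Icc_subset hab hsub hg hpn hy]
        exact hK _ le_rfl y (hsub hy))
    have he : taylorWithinEval g m (Set.Icc a (a + h)) a (a + x * h) =
        ∑ k ∈ Finset.range (m + 1), c k * (x : ℂ) ^ k := by
      rw [taylor_within_apply]
      refine Finset.sum_congr rfl fun k hk => ?_
      have := Finset.mem_range.1 hk
      rw [iteratedDerivWithin_Icc_subset hab hsub hg (by omega) ha', Complex.real_smul, hcdef]
      push_cast
      ring
    rw [he] at ht
    refine ht.trans ?_
    have hfac : (1 : ℝ) ≤ m.factorial := by
      exact_mod_cast Nat.one_le_iff_ne_zero.2 (Nat.factorial_ne_zero m)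
    have hxh : 0 ≤ a + x * h - a := by nlinarith [hx01.1]
    refine (div_le_self (by positivity) hfac).trans ?_
    gcongr
    nlinarith [hx01.2]
  have hpoly : Continuous (fun x : ℝ => ∑ k ∈ Finset.range (m + 1), c k * (x : ℂ) ^ k) := by
    fun_prop
  have hgc : ContinuousOn (fun x : ℝ => g (a + x * h)) (Set.Icc 0 1) :=
    hgsub.continuousOn.comp (by fun_prop) hx
  have hdec := R.quadDefect_add z hpoly.continuousOn (hgc.sub hpoly.continuousOn)
  simp only [Pi.sub_apply, add_sub_cancel] at hdec
  rw [hdec, R.quadDefect_sum_pow]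
  refine (norm_add_le _ _).trans ?_
  rw [add_mul, add_mul]
  refine add_le_add ?_ ((hB z hz hz1 _ _ htaylor).trans (by rw [mul_assoc]))
  rw [Finset.sum_mul, Finset.sum_mul]
  refine norm_sum_le_of_le _ fun k hk => ?_
  have hkp := Finset.mem_range.1 hk
  have hck : ‖c k‖ ≤ h ^ k * K := by
    rw [hcdef]
    simp only [norm_mul, norm_inv, norm_pow, Complex.norm_natCast, Complex.norm_real,
      Real.norm_of_nonneg hh.le]
    have hfac : ((k.factorial : ℝ))⁻¹ ≤ 1 := inv_le_one_of_one_le₀ (by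
      exact_mod_cast Nat.one_le_iff_ne_zero.2 (Nat.factorial_ne_zero k))
    calc _ ≤ 1 * h ^ k * K := by
          gcongr
          exact hK k hkp.le a (hsub ha')
      _ = _ := by ring
  have hzk : ‖z‖ ^ (m + 1 - k) ≤ |σ| ^ (m + 1 - k) * h ^ (m + 1 - k) := by
    rw [← mul_pow]
    gcongr
    exact hzσ.trans (by gcongr; exact le_abs_self σ)
  -- The balance of powers: `h^k` from the Taylor coefficient, `h^(p - k)` from the defect of `x^k`.
  have hpow : h ^ (m + 1) = h ^ k * h ^ (m + 1 - k) := by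
    rw [← pow_add]; congr 1; omega
  rw [norm_mul]
  calc _ ≤ (h ^ k * K) * (C * (|σ| ^ (m + 1 - k) * h ^ (m + 1 - k))) :=
        mul_le_mul hck ((hC k hkp z hz hz1).trans (by gcongr)) (norm_nonneg _) (by positivity)
    _ = _ := by rw [hpow]; ring

theorem HasOrder.exists_error_bound {R : RKTableau S} {p : ℕ} (hp : R.HasOrder p)
    (hp1 : 1 ≤ p) (hL : R.LStable) (hR : R.EigenvaluesPos)
    (hc : ∀ i, R.c i ∈ Set.Icc (0 : ℝ) 1) {t : ℝ} (ht : 0 < t) (σ : ℝ) :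
    ∃ C : ℝ, 0 ≤ C ∧ ∀ (T : ℝ) (γ : ℕ) (g : ℝ → ℂ) (s : ℂ) (h : ℝ) (N : ℕ) (Y : ℕ → ℂ),
      0 < T → T ≤ t → p ≤ γ → ContDiffOn ℝ γ g (Set.Icc 0 T) → 0 ≤ s.re → ‖s‖ ≤ σ → 0 < h →
      N * h = T → ‖s * h‖ ≤ 1 → R.IsSolution s g h N Y →
      ‖expConv s g T - Y N‖ ≤ C * h ^ p * dataNorm g p T := by
  obtain ⟨C₁, hC₁0, hC₁⟩ := hp.exists_quadDefect_smooth_bound hp1 hR hc σ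
  obtain ⟨C₂, hC₂0, hC₂⟩ := hp.exists_quadDefect_pow_bound hR
  refine ⟨t * (C₂ * |σ| ^ (p + 1) * t + C₁) * (1 + t) ^ p, by positivity, ?_⟩
  intro T γ g s h N Y hT hTt hpγ hg hs hsσ hh hN hsh hY
  set z : ℂ := -s * h with hzdef
  have hz : z.re ≤ 0 := by
    rw [hzdef, Complex.re_mul_ofReal, Complex.neg_re]
    nlinarith
  have hznorm : ‖z‖ = ‖s‖ * h := by
    rw [hzdef, norm_mul, norm_neg, Complex.norm_real, Real.norm_of_nonneg hh.le]
  have hz1 : ‖z‖ ≤ 1 := by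
    rw [hzdef, neg_mul, norm_neg]; exact hsh
  have hzσ : ‖z‖ ≤ σ * h := by rw [hznorm]; gcongr
  have hzσ' : ‖z‖ ≤ |σ| * h := hzσ.trans (by gcongr; exact le_abs_self σ)
  have hD := dataNorm_nonneg g p T
  set K : ℝ := (1 + t) ^ p * dataNorm g p T with hKdef
  have hK0 : 0 ≤ K := by positivity
  have hK : ∀ k ≤ p, ∀ x ∈ Set.Icc 0 T, ‖iteratedDerivWithin k g (Set.Icc 0 T) x‖ ≤ K := by
    intro k hk x hx
    refine (norm_iteratedDerivWithin_le_dataNorm hT hpγ hg (p - k) k (by omega) x hx).trans ?_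
    rw [hKdef]
    gcongr
    calc (1 + T) ^ (p - k) ≤ (1 + t) ^ (p - k) := by gcongr
      _ ≤ (1 + t) ^ p := pow_le_pow_right₀ (by linarith) (Nat.sub_le _ _)
  -- Bound for one local error: the first summand comes from `e^z - r(z)` acting on the exact
  -- solution, which is at most `K t`; the second from the quadrature of `g`.
  set δ : ℝ := (C₂ * |σ| ^ (p + 1) * t + C₁) * K * h ^ (p + 1) with hδ
  have hmain : ∀ n : ℕ, n ≤ N → ‖expConv s g (n * h) - Y n‖ ≤ n * δ := by
    intro n
    induction n with
    | zero => intro _; simp [hY.1, expConv]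
    | succ n ih =>
      intro hn
      have hnT : (n : ℝ) * h + h ≤ T := by
        rw [← hN]
        have : ((n + 1 : ℕ) : ℝ) ≤ N := by exact_mod_cast hn
        push_cast at this
        nlinarith
      have hn0 : 0 ≤ (n : ℝ) * h := by positivity
      have hstep := (hR.isStep_iff hz).1 (hY.2 n hn)
      have hexact := expConv_add (s := s) hn0 hh
        (hg.continuousOn.mono (Set.Icc_subset_Icc le_rfl hnT))
      -- The propagator error multiplies the exact value, not the numerical one, so no separate
      -- bound on `Y n` is needed.
      have hrec : expConv s g ((n + 1 : ℕ) * h) - Y (n + 1) =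
          R.stab z * (expConv s g (n * h) - Y n)
          + (z * R.quadDefect z (fun x => (x : ℂ) ^ 0)) * expConv s g (n * h)
          + h * R.quadDefect z (fun x => g (n * h + x * h)) := by
        rw [← exp_sub_stab, show ((n + 1 : ℕ) : ℝ) * h = n * h + h by push_cast; ring, hexact,
          hstep, quadDefect]
        ring
      have h1 : ‖R.stab z * (expConv s g (n * h) - Y n)‖ ≤ n * δ := by
        rw [norm_mul]
        calc _ ≤ 1 * ‖expConv s g (n * h) - Y n‖ := by
              gcongr
              exact hL.1 z hz
          _ ≤ _ := by rw [one_mul]; exact ih (by omega)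
      have h2 : ‖(z * R.quadDefect z (fun x => (x : ℂ) ^ 0)) * expConv s g (n * h)‖ ≤
          C₂ * |σ| ^ (p + 1) * t * K * h ^ (p + 1) := by
        have hq := hC₂ 0 (by omega) z hz hz1
        rw [Nat.sub_zero] at hq
        have he := norm_expConv_le hs hn0 (g := g) (K := K) (fun x hx => by
          simpa using hK 0 (Nat.zero_le _) x ⟨hx.1, hx.2.trans (by linarith)⟩)
        rw [norm_mul, norm_mul]
        calc _ ≤ (‖z‖ * (C₂ * ‖z‖ ^ p)) * (K * t) := by
              gcongr
              refine he.trans ?_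
              gcongr
              linarith
          _ = C₂ * ‖z‖ ^ (p + 1) * (K * t) := by ring
          _ ≤ C₂ * (|σ| * h) ^ (p + 1) * (K * t) := by gcongr
          _ = _ := by ring
      have h3 : ‖h * R.quadDefect z (fun x => g (n * h + x * h))‖ ≤ C₁ * K * h ^ (p + 1) := by
        rw [norm_mul, Complex.norm_real, Real.norm_of_nonneg hh.le]
        calc _ ≤ h * (C₁ * K * h ^ p) := by
              gcongr
              exact hC₁ g γ T (n * h) h K z hpγ hg hn0 hh hnT hK hz hz1 hzσ
          _ = _ := by ring
      rw [hrec]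
      refine (norm_add₃_le).trans ?_
      have : ((n + 1 : ℕ) : ℝ) * δ = n * δ + C₂ * |σ| ^ (p + 1) * t * K * h ^ (p + 1)
          + C₁ * K * h ^ (p + 1) := by
        rw [hδ]; push_cast; ring
      rw [this]
      gcongr
  have hfin := hmain N le_rfl
  rw [hN] at hfin
  refine hfin.trans ?_
  calc (N : ℝ) * δ = (N * h) * ((C₂ * |σ| ^ (p + 1) * t + C₁) * K * h ^ p) := by rw [hδ]; ring
    _ ≤ t * ((C₂ * |σ| ^ (p + 1) * t + C₁) * K * h ^ p) := by
        rw [hN]; gcongr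
    _ = _ := by rw [hKdef]; ring

end RKTableau

/-! ### Interpolation error -/

theorem exists_strictMono_zeros_deriv {a b : ℝ} {u u' : ℝ → ℝ}
    (hu : ∀ y ∈ Set.Icc a b, HasDerivWithinAt u (u' y) (Set.Icc a b) y) {n : ℕ}
    {x : Fin (n + 1) → ℝ} (hx : StrictMono x) (hxab : ∀ i, x i ∈ Set.Icc a b)
    (h0 : ∀ i, u (x i) = 0) :
    ∃ x' : Fin n → ℝ, StrictMono x' ∧ (∀ i, x' i ∈ Set.Icc a b) ∧ ∀ i, u' (x' i) = 0 := by
  have key : ∀ i : Fin n, ∃ c ∈ Set.Ioo (x i.castSucc) (x i.succ), u' c = 0 := by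
    intro i
    have hsub : Set.Icc (x i.castSucc) (x i.succ) ⊆ Set.Icc a b :=
      Set.Icc_subset_Icc (hxab _).1 (hxab _).2
    refine exists_hasDerivAt_eq_zero (hx i.castSucc_lt_succ)
      (fun y hy => (hu y (hsub hy)).continuousWithinAt.mono hsub) (by rw [h0, h0]) ?_
    intro y hy
    refine (hu y (hsub (Set.Ioo_subset_Icc_self hy))).hasDerivAt ?_
    exact Filter.mem_of_superset (Ioo_mem_nhds hy.1 hy.2) (Set.Ioo_subset_Icc_self.trans hsub)
  choose c hc hc0 using key
  refine ⟨c, fun i j hij => ?_, fun i => ⟨(hxab _).1.trans (hc i).1.le,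
    (hc i).2.le.trans (hxab _).2⟩, hc0⟩
  have : i.succ ≤ j.castSucc := by
    rw [Fin.le_def, Fin.val_succ, Fin.val_castSucc]
    exact hij
  exact (hc i).2.trans_le ((hx.monotone this).trans (hc j).1.le)

/-- Repeated Rolle gives every `u k` with `k < L` a zero. Integrating back from the bound on `u L`,
each level costs a factor `b - a`. -/
theorem abs_le_of_zeros {a b K : ℝ} {L : ℕ} : ∀ {u : ℕ → ℝ → ℝ} {x : Fin L → ℝ},
    (∀ k < L, ∀ y ∈ Set.Icc a b, HasDerivWithinAt (u k) (u (k + 1) y) (Set.Icc a b) y) →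
    StrictMono x → (∀ i, x i ∈ Set.Icc a b) → (∀ i, u 0 (x i) = 0) →
    (∀ y ∈ Set.Icc a b, |u L y| ≤ K) → ∀ y ∈ Set.Icc a b, |u 0 y| ≤ K * (b - a) ^ L := by
  induction L with
  | zero =>
    intro u x _ _ _ _ hK y hy
    simpa using hK y hy
  | succ L ih =>
    intro u x hu hx hxab h0 hK y hy
    obtain ⟨x', hx', hxab', h0'⟩ :=
      exists_strictMono_zeros_deriv (hu 0 (Nat.succ_pos L)) hx hxab h0
    have h1 := ih (u := fun k => u (k + 1)) (fun k hk => hu (k + 1) (by omega)) hx' hxab' h0' hK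
    have hmv := (convex_Icc a b).norm_image_sub_le_of_norm_hasDerivWithin_le
      (hu 0 (Nat.succ_pos L)) h1 (hxab 0) hy
    rw [h0, sub_zero, Real.norm_eq_abs] at hmv
    have hd : ‖y - x 0‖ ≤ b - a := by
      rw [Real.norm_eq_abs, abs_le]
      constructor <;> linarith [(hxab 0).1, (hxab 0).2, hy.1, hy.2]
    have hK0 : 0 ≤ K * (b - a) ^ L := (abs_nonneg _).trans (h1 y hy)
    calc |u 0 y| ≤ K * (b - a) ^ L * ‖y - x 0‖ := hmv
      _ ≤ K * (b - a) ^ L * (b - a) := by gcongr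
      _ = K * (b - a) ^ (L + 1) := by ring

theorem strictMono_comp_sort {L : ℕ} {x : Fin L → ℝ} (hx : Function.Injective x) :
    StrictMono (x ∘ Tuple.sort x) :=
  (Tuple.monotone_sort x).strictMono_of_injective (hx.comp (Tuple.sort x).injective)

/-- Rolle's theorem fails for complex values, so a real functional `φ` is applied first. The `L`-th
derivative of the error is that of `g`, because the interpolant has degree below `L`. -/
theorem interp_error_component {φ : ℂ →L[ℝ] ℝ} (hφ : ∀ w, |φ w| ≤ ‖w‖) {t a b K : ℝ} {γ L : ℕ}
    {g : ℝ → ℂ} (ht : 0 < t) (hab : Set.Icc a b ⊆ Set.Icc 0 t) (hLγ : L ≤ γ)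
    (hg : ContDiffOn ℝ γ g (Set.Icc 0 t))
    (hK : ∀ y ∈ Set.Icc 0 t, ‖iteratedDerivWithin L g (Set.Icc 0 t) y‖ ≤ K) {x : Fin L → ℝ}
    (hx : Function.Injective x) (hxab : ∀ i, x i ∈ Set.Icc a b) {y : ℝ} (hy : y ∈ Set.Icc a b) :
    |φ (g y - (interp x g).eval (y : ℂ))| ≤ K * (b - a) ^ L := by
  set G := interp x g with hG
  have hinj : Set.InjOn (fun i => (x i : ℂ)) (Finset.univ : Finset (Fin L)) :=
    (Complex.ofReal_injective.comp hx).injOn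
  have hGx : ∀ i, G.eval (x i : ℂ) = g (x i) := fun i =>
    Lagrange.eval_interpolate_at_node (fun i => g (x i)) hinj (Finset.mem_univ i)
  have hGL : Polynomial.derivative^[L] G = 0 := by
    apply Polynomial.iterate_derivative_eq_zero_of_degree_lt
    have h := Lagrange.degree_interpolate_lt (fun i => g (x i)) hinj
    rwa [Finset.card_univ, Fintype.card_fin] at h
  have h := abs_le_of_zeros (a := a) (b := b) (K := K) (L := L)
    (u := fun k y => φ (iteratedDerivWithin k g (Set.Icc 0 t) y
      - (Polynomial.derivative^[k] G).eval (y : ℂ))) (x := x ∘ Tuple.sort x)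
    ?_ (strictMono_comp_sort hx) (fun i => hxab _) ?_ ?_ y hy
  · simpa using h
  · intro k hk y hy
    have h1 := (hasDerivWithinAt_iteratedDerivWithin ht hg (hk.trans_le hLγ) (hab hy)).mono hab
    have h2 := ((Polynomial.derivative^[k] G).hasDerivAt (y : ℂ)).comp_ofReal.hasDerivWithinAt
      (s := Set.Icc a b)
    rw [← Function.iterate_succ_apply' Polynomial.derivative] at h2
    exact φ.hasFDerivAt.comp_hasDerivWithinAt y (h1.sub h2)
  · intro i
    simp [hGx]
  · intro y hy
    simp only [hGL, Polynomial.eval_zero, sub_zero]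
    exact (hφ _).trans (hK y (hab hy))

theorem interp_error {t a b K : ℝ} {γ L : ℕ} {g : ℝ → ℂ} (ht : 0 < t)
    (hab : Set.Icc a b ⊆ Set.Icc 0 t) (hLγ : L ≤ γ) (hg : ContDiffOn ℝ γ g (Set.Icc 0 t))
    (hK : ∀ y ∈ Set.Icc 0 t, ‖iteratedDerivWithin L g (Set.Icc 0 t) y‖ ≤ K) {x : Fin L → ℝ}
    (hx : Function.Injective x) (hxab : ∀ i, x i ∈ Set.Icc a b) {y : ℝ} (hy : y ∈ Set.Icc a b) :
    ‖g y - (interp x g).eval (y : ℂ)‖ ≤ 2 * (K * (b - a) ^ L) := by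
  have h1 := interp_error_component (φ := Complex.reCLM) Complex.abs_re_le_norm ht hab hLγ hg hK
    hx hxab hy
  have h2 := interp_error_component (φ := Complex.imCLM) Complex.abs_im_le_norm ht hab hLγ hg hK
    hx hxab hy
  rw [Complex.reCLM_apply] at h1
  rw [Complex.imCLM_apply] at h2
  linarith [Complex.norm_le_abs_re_add_abs_im (g y - (interp x g).eval (y : ℂ))]

/-! ### The singular part -/

theorem intervalIntegrable_genTaylor (a : ℕ → ℂ) {α : ℝ} (hα : α < 1) (M : ℕ) (c d : ℝ) :
    IntervalIntegrable (genTaylor a α M) MeasureTheory.volume c d := by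
  have h1 : IntervalIntegrable (fun τ : ℝ => ((τ ^ (-α) : ℝ) : ℂ)) MeasureTheory.volume c d :=
    ⟨((intervalIntegral.intervalIntegrable_rpow' (by linarith : -1 < -α)).1).ofReal,
      ((intervalIntegral.intervalIntegrable_rpow' (by linarith : -1 < -α)).2).ofReal⟩
  exact (h1.const_mul (a 0)).add (Continuous.intervalIntegrable (by fun_prop) _ _)

/-- Below some `δ` the integrand is at most `τ^M`. For `t₀ ≥ δ` the integral over all of `[0, t]` is
a constant, absorbed by `(t₀ / δ)^(M+1) ≥ 1`. -/
theorem HasGenTaylor.exists_integral_bound {f : ℝ → ℂ} {a : ℕ → ℂ} {α t : ℝ} (hα : α < 1)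
    (hf : HasGenTaylor f a α) (hfi : IntervalIntegrable f MeasureTheory.volume 0 t) (M : ℕ) :
    ∃ C : ℝ, 0 ≤ C ∧ ∀ t₀ : ℝ, 0 ≤ t₀ → t₀ ≤ t →
      ∫ τ in (0 : ℝ)..t₀, ‖f τ - genTaylor a α M τ‖ ≤ C * t₀ ^ (M + 1) := by
  have hint : IntervalIntegrable (fun τ => ‖f τ - genTaylor a α M τ‖) MeasureTheory.volume 0 t :=
    (hfi.sub (intervalIntegrable_genTaylor a hα M 0 t)).norm
  obtain ⟨δ, hδ0, hδ⟩ := mem_nhdsGT_iff_exists_Ioo_subset.1 ((hf M).def zero_lt_one)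
  have hδ0 : 0 < δ := hδ0
  refine ⟨1 + |∫ τ in (0 : ℝ)..t, ‖f τ - genTaylor a α M τ‖| / δ ^ (M + 1), by positivity, ?_⟩
  intro t₀ ht₀ ht₀t
  rw [add_mul, one_mul]
  rcases lt_or_ge t₀ δ with hlt | hge
  · have h := intervalIntegral.norm_integral_le_of_norm_le_const (a := 0) (b := t₀)
      (C := t₀ ^ M) (f := fun τ => ‖f τ - genTaylor a α M τ‖) ?_
    · rw [sub_zero, abs_of_nonneg ht₀, ← pow_succ] at h
      refine ((le_abs_self _).trans h).trans (le_add_of_nonneg_right (by positivity))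
    · intro τ hτ
      rw [Set.uIoc_of_le ht₀] at hτ
      have h1 := hδ ⟨hτ.1, hτ.2.trans_lt hlt⟩
      simp only [Set.mem_ofPred_eq, one_mul, norm_pow, Real.norm_of_nonneg hτ.1.le] at h1
      rw [norm_norm]
      exact h1.trans (pow_le_pow_left₀ hτ.1.le hτ.2 M)
  · have h1 : ∫ τ in (0 : ℝ)..t₀, ‖f τ - genTaylor a α M τ‖ ≤
        ∫ τ in (0 : ℝ)..t, ‖f τ - genTaylor a α M τ‖ :=
      intervalIntegral.integral_mono_interval le_rfl ht₀ ht₀t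
        (Eventually.of_forall fun _ => norm_nonneg _) hint
    have h2 : |∫ τ in (0 : ℝ)..t, ‖f τ - genTaylor a α M τ‖| ≤
        |∫ τ in (0 : ℝ)..t, ‖f τ - genTaylor a α M τ‖| / δ ^ (M + 1) * t₀ ^ (M + 1) := by
      rw [div_mul_eq_mul_div, le_div_iff₀ (by positivity)]
      gcongr
    have h3 : 0 ≤ t₀ ^ (M + 1) := by positivity
    linarith [le_abs_self (∫ τ in (0 : ℝ)..t, ‖f τ - genTaylor a α M τ‖)]

theorem continuousOn_comp_sub {g : ℝ → ℂ} {t c d : ℝ} (hg : ContinuousOn g (Set.Icc 0 t))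
    (hc : 0 ≤ c) (hcd : c ≤ d) (hd : d ≤ t) :
    ContinuousOn (fun τ => g (t - τ)) (Set.uIcc c d) := by
  rw [Set.uIcc_of_le hcd]
  refine hg.comp (by fun_prop) fun τ hτ => ?_
  constructor <;> linarith [hτ.1, hτ.2]

theorem singular_error {f g : ℝ → ℂ} {a : ℕ → ℂ} {α t t₀ K J δ : ℝ} {M : ℕ} {G : Polynomial ℂ}
    (hα : α < 1) (ht₀ : 0 ≤ t₀) (ht₀t : t₀ ≤ t)
    (hfi : IntervalIntegrable f MeasureTheory.volume 0 t) (hg : ContinuousOn g (Set.Icc 0 t))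
    (hK : ∀ y ∈ Set.Icc 0 t, ‖g y‖ ≤ K)
    (hJ : ∫ τ in (0 : ℝ)..t₀, ‖f τ - genTaylor a α M τ‖ ≤ J) (hδ : 0 ≤ δ)
    (hG : ∀ y ∈ Set.Icc (t - t₀) t, ‖g y - G.eval (y : ℂ)‖ ≤ δ) :
    ‖(∫ τ in (0 : ℝ)..t₀, f τ * g (t - τ)) - singularApprox a α M G t t₀‖ ≤
      K * J + δ * ∫ τ in (0 : ℝ)..t, ‖genTaylor a α M τ‖ := by
  have hT := intervalIntegrable_genTaylor a hα M 0 t₀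
  have hf₀ : IntervalIntegrable f MeasureTheory.volume 0 t₀ :=
    hfi.mono_set (by
      rw [Set.uIcc_of_le ht₀, Set.uIcc_of_le (ht₀.trans ht₀t)]
      exact Set.Icc_subset_Icc le_rfl ht₀t)
  have hK0 : 0 ≤ K := (norm_nonneg _).trans (hK t ⟨ht₀.trans ht₀t, le_rfl⟩)
  have hd : IntervalIntegrable (fun τ => ‖f τ - genTaylor a α M τ‖) MeasureTheory.volume 0 t₀ :=
    (hf₀.sub hT).norm
  rw [singularApprox, ← intervalIntegral.integral_sub
    (hf₀.mul_continuousOn (continuousOn_comp_sub hg le_rfl ht₀ ht₀t))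
    (hT.mul_continuousOn (Continuous.continuousOn (by fun_prop)))]
  have hmono : ∫ τ in (0 : ℝ)..t₀, ‖genTaylor a α M τ‖ ≤ ∫ τ in (0 : ℝ)..t, ‖genTaylor a α M τ‖ :=
    intervalIntegral.integral_mono_interval le_rfl ht₀ ht₀t
      (Eventually.of_forall fun _ => norm_nonneg _) (intervalIntegrable_genTaylor a hα M 0 t).norm
  refine (intervalIntegral.norm_integral_le_of_norm_le ht₀ (g := fun τ =>
    K * ‖f τ - genTaylor a α M τ‖ + δ * ‖genTaylor a α M τ‖) ?_
    ((hd.const_mul K).add (hT.norm.const_mul δ))).trans ?_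
  · refine Eventually.of_forall fun τ hτ => ?_
    have h1 : t - τ ∈ Set.Icc (t - t₀) t := by constructor <;> linarith [hτ.1, hτ.2]
    have h2 : t - τ ∈ Set.Icc 0 t := ⟨by linarith [h1.1], h1.2⟩
    have he : f τ * g (t - τ) - genTaylor a α M τ * G.eval ((t - τ : ℝ) : ℂ) =
        g (t - τ) * (f τ - genTaylor a α M τ)
          + (g (t - τ) - G.eval ((t - τ : ℝ) : ℂ)) * genTaylor a α M τ := by ring
    rw [he]
    refine (norm_add_le _ _).trans ?_
    rw [norm_mul, norm_mul]
    gcongr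
    · exact hK _ h2
    · exact hG _ h1
  · rw [intervalIntegral.integral_add (hd.const_mul K) (hT.norm.const_mul δ),
      intervalIntegral.integral_const_mul, intervalIntegral.integral_const_mul]
    gcongr

/-! ### The regular part -/

/-- The substitution `τ ↦ t - τ` factors `e^{-s t₀}` out of each exponential and leaves a
convolution over `[0, t - t₀]`. -/
theorem integral_soe_mul {P : ℕ} (m s : Fin P → ℂ) {g : ℝ → ℂ} {t t₀ : ℝ} (ht₀ : 0 ≤ t₀)
    (ht₀t : t₀ ≤ t) (hg : ContinuousOn g (Set.Icc 0 t)) :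
    ∫ τ in t₀..t, soe m s τ * g (t - τ) =
      ∑ ℓ, m ℓ * Complex.exp (-s ℓ * (t₀ : ℂ)) * expConv (s ℓ) g (t - t₀) := by
  simp only [soe, Finset.sum_mul]
  rw [intervalIntegral.integral_finsetSum]
  · refine Finset.sum_congr rfl fun ℓ _ => ?_
    have h := intervalIntegral.integral_comp_sub_left (a := 0) (b := t - t₀)
      (fun τ => m ℓ * Complex.exp (-s ℓ * (τ : ℂ)) * g (t - τ)) t
    rw [sub_zero, sub_sub_cancel] at h
    rw [← h, expConv, ← intervalIntegral.integral_const_mul]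
    congr 1
    ext τ
    rw [sub_sub_cancel, show -s ℓ * ((t - τ : ℝ) : ℂ) =
      -s ℓ * (t₀ : ℂ) + -s ℓ * ((t - t₀ - τ : ℝ) : ℂ) by push_cast; ring, Complex.exp_add]
    ring
  · intro ℓ _
    apply ContinuousOn.intervalIntegrable
    exact ContinuousOn.mul (by fun_prop) (continuousOn_comp_sub hg ht₀ ht₀t le_rfl)

theorem regular_error {P : ℕ} {m s : Fin P → ℂ} {f g : ℝ → ℂ} {t t₀ K ε W δ : ℝ} {N : ℕ}
    {Y : Fin P → ℕ → ℂ} (ht₀ : 0 ≤ t₀) (ht₀t : t₀ < t)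
    (hfi : IntervalIntegrable f MeasureTheory.volume 0 t) (hg : ContinuousOn g (Set.Icc 0 t))
    (hK : ∀ y ∈ Set.Icc 0 t, ‖g y‖ ≤ K) (hε : ∀ y ∈ Set.Ioc t₀ t, ‖f y - soe m s y‖ ≤ ε)
    (hW : ∑ ℓ, ‖m ℓ‖ ≤ W) (hs : ∀ ℓ, 0 ≤ (s ℓ).re) (hδ : 0 ≤ δ)
    (hY : ∀ ℓ, ‖expConv (s ℓ) g (t - t₀) - Y ℓ N‖ ≤ δ) :
    ‖(∫ τ in t₀..t, f τ * g (t - τ)) - regularApprox m s t₀ N Y‖ ≤ ε * K * t + W * δ := by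
  have hε0 : 0 ≤ ε := (norm_nonneg _).trans (hε t ⟨ht₀t, le_rfl⟩)
  have hK0 : 0 ≤ K := (norm_nonneg _).trans (hK t ⟨ht₀.trans ht₀t.le, le_rfl⟩)
  have hgc := continuousOn_comp_sub hg ht₀ ht₀t.le le_rfl
  have hf₀ : IntervalIntegrable f MeasureTheory.volume t₀ t :=
    hfi.mono_set (by
      rw [Set.uIcc_of_le ht₀t.le, Set.uIcc_of_le (ht₀.trans ht₀t.le)]
      exact Set.Icc_subset_Icc ht₀ le_rfl)
  have hsoe : Continuous (soe m s) := by
    unfold soe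
    fun_prop
  have h1 : ‖(∫ τ in t₀..t, f τ * g (t - τ)) - ∫ τ in t₀..t, soe m s τ * g (t - τ)‖ ≤
      ε * K * t := by
    rw [← intervalIntegral.integral_sub (hf₀.mul_continuousOn hgc)
      ((hsoe.intervalIntegrable _ _).mul_continuousOn hgc)]
    have h := intervalIntegral.norm_integral_le_of_norm_le_const (a := t₀) (b := t) (C := ε * K)
      (f := fun τ => f τ * g (t - τ) - soe m s τ * g (t - τ)) ?_
    · refine h.trans ?_
      rw [abs_of_nonneg (by linarith)]
      gcongr
      linarith
    · intro τ hτ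
      rw [Set.uIoc_of_le ht₀t.le] at hτ
      rw [← sub_mul, norm_mul]
      have := hK (t - τ) (by constructor <;> linarith [hτ.1, hτ.2])
      have := hε τ hτ
      gcongr
  have h2 : ‖(∫ τ in t₀..t, soe m s τ * g (t - τ)) - regularApprox m s t₀ N Y‖ ≤ W * δ := by
    rw [integral_soe_mul m s ht₀ ht₀t.le hg, regularApprox, ← Finset.sum_sub_distrib]
    calc _ ≤ ∑ ℓ, ‖m ℓ‖ * δ := by
          refine norm_sum_le_of_le _ fun ℓ _ => ?_
          rw [← mul_sub, norm_mul, norm_mul]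
          calc _ ≤ ‖m ℓ‖ * 1 * δ := by
                gcongr
                · exact norm_exp_neg_mul_le_one (hs ℓ) ht₀
                · exact hY ℓ
            _ = _ := by rw [mul_one]
      _ = (∑ ℓ, ‖m ℓ‖) * δ := by rw [Finset.sum_mul]
      _ ≤ W * δ := by gcongr
  exact (norm_sub_le_norm_sub_add_norm_sub _ _ _).trans (add_le_add h1 h2)

/-! ### Assembling the error of the convolution quadrature -/

theorem convInt_eq_add {f g : ℝ → ℂ} {t t₀ : ℝ} (ht₀ : 0 ≤ t₀) (ht₀t : t₀ ≤ t)
    (hfi : IntervalIntegrable f MeasureTheory.volume 0 t) (hg : ContinuousOn g (Set.Icc 0 t)) :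
    convInt f g t =
      (∫ τ in (0 : ℝ)..t₀, f τ * g (t - τ)) + ∫ τ in t₀..t, f τ * g (t - τ) := by
  have ht : 0 ≤ t := ht₀.trans ht₀t
  have hint := hfi.mul_continuousOn (continuousOn_comp_sub hg le_rfl ht le_rfl)
  have hmem : t₀ ∈ Set.uIcc 0 t := by rw [Set.uIcc_of_le ht]; exact ⟨ht₀, ht₀t⟩
  rw [intervalIntegral.integral_add_adjacent_intervals
    (hint.mono_set (Set.uIcc_subset_uIcc_left hmem))
    (hint.mono_set (Set.uIcc_subset_uIcc_right hmem))]
  have h := intervalIntegral.integral_comp_sub_left (a := 0) (b := t)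
    (fun τ => f τ * g (t - τ)) t
  simp only [sub_zero, sub_self, sub_sub_cancel] at h
  rw [← h, convInt]

/-- This makes the constant independent of `t₀`. -/
theorem dataNorm_mono {g : ℝ → ℂ} {p n : ℕ} {T t : ℝ} (hT : 0 < T) (hTt : T ≤ t) (hpn : p ≤ n)
    (hg : ContDiffOn ℝ n g (Set.Icc 0 t)) : dataNorm g p T ≤ dataNorm g p t := by
  have hsub : Set.Icc 0 T ⊆ Set.Icc 0 t := Set.Icc_subset_Icc le_rfl hTt
  refine add_le_add (le_of_eq (Finset.sum_congr rfl fun k hk => ?_)) ?_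
  · rw [iteratedDerivWithin_Icc_subset hT hsub hg ((Finset.mem_range.1 hk).le.trans hpn)
      ⟨le_rfl, hT.le⟩]
  · refine csSup_le ⟨_, 0, ⟨le_rfl, hT.le⟩, rfl⟩ ?_
    rintro _ ⟨x, hx, rfl⟩
    refine le_csSup (bddAbove_norm_iteratedDerivWithin (hT.trans_le hTt) hpn hg)
      ⟨x, hsub hx, ?_⟩
    simp only
    rw [iteratedDerivWithin_Icc_subset hT hsub hg hpn hx]

theorem pow_le_one_add_pow_mul_pow {h t : ℝ} (hh : 0 ≤ h) (hht : h ≤ t) {k m : ℕ} (hkm : k ≤ m) :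
    h ^ m ≤ (1 + t) ^ m * h ^ k := by
  obtain ⟨j, rfl⟩ := Nat.exists_eq_add_of_le hkm
  calc h ^ (k + j) = h ^ j * h ^ k := by rw [pow_add, mul_comm]
    _ ≤ (1 + t) ^ j * h ^ k := by gcongr; linarith
    _ ≤ (1 + t) ^ (k + j) * h ^ k := by
        gcongr
        · linarith
        · omega

theorem RKTableau.HasOrder.exists_quadrature_bound {S : ℕ} {R : RKTableau S} {p : ℕ}
    (hp : R.HasOrder p) (hp1 : 1 ≤ p) (hL : R.LStable) (hR : R.EigenvaluesPos)
    (hc : ∀ i, R.c i ∈ Set.Icc (0 : ℝ) 1) {t : ℝ} {f g : ℝ → ℂ} {a : ℕ → ℂ} {α : ℝ}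
    {γ L : ℕ} (M : ℕ) (κ σ W : ℝ) (ht : 0 < t) (hfi : IntervalIntegrable f MeasureTheory.volume 0 t)
    (hα : α < 1) (hf : HasGenTaylor f a α) (hpγ : p ≤ γ) (hLγ : L ≤ γ)
    (hg : ContDiffOn ℝ γ g (Set.Icc 0 t)) :
    ∃ C : ℝ, 0 ≤ C ∧
      ∀ (t₀ h ε : ℝ) (N P : ℕ) (m s : Fin P → ℂ) (x : Fin L → ℝ) (Y : Fin P → ℕ → ℂ),
        0 ≤ t₀ → t₀ < t → 0 < h → t₀ ≤ κ * h → N * h = t - t₀ →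
        Function.Injective x → (∀ i, x i ∈ Set.Icc (t - t₀) t) →
        (∀ y ∈ Set.Ioc t₀ t, ‖f y - soe m s y‖ ≤ ε) → ∑ ℓ, ‖m ℓ‖ ≤ W →
        (∀ ℓ, 0 ≤ (s ℓ).re) → (∀ ℓ, ‖s ℓ‖ ≤ σ) → (∀ ℓ, ‖s ℓ * h‖ ≤ 1) →
        (∀ ℓ, R.IsSolution (s ℓ) g h N (Y ℓ)) →
        ‖convInt f g t
            - (singularApprox a α M (interp x g) t t₀ + regularApprox m s t₀ N Y)‖
          ≤ C * (h ^ min (M + 1) (min L p) + ε) := by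
  obtain ⟨C₁, hC₁0, hC₁⟩ := hf.exists_integral_bound hα hfi M
  obtain ⟨C₂, hC₂0, hC₂⟩ := hp.exists_error_bound hp1 hL hR hc ht σ
  have hbound : ∀ k ≤ γ, ∃ K : ℝ, 0 ≤ K ∧ ∀ y ∈ Set.Icc 0 t,
      ‖iteratedDerivWithin k g (Set.Icc 0 t) y‖ ≤ K := by
    intro k hk
    obtain ⟨K, hK⟩ := isCompact_Icc.exists_bound_of_continuousOn
      (hg.continuousOn_iteratedDerivWithin (by exact_mod_cast hk) (uniqueDiffOn_Icc ht))
    exact ⟨K, (norm_nonneg _).trans (hK 0 ⟨le_rfl, ht.le⟩), hK⟩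
  obtain ⟨K₀, hK₀0, hK₀⟩ := hbound 0 (Nat.zero_le _)
  simp only [iteratedDerivWithin_zero] at hK₀
  obtain ⟨K₁, hK₁0, hK₁⟩ := hbound L hLγ
  set J : ℝ := ∫ τ in (0 : ℝ)..t, ‖genTaylor a α M τ‖ with hJ
  have hJ0 : 0 ≤ J := intervalIntegral.integral_nonneg ht.le fun _ _ => norm_nonneg _
  have hD0 := dataNorm_nonneg g p t
  refine ⟨K₀ * C₁ * |κ| ^ (M + 1) * (1 + t) ^ (M + 1) + 2 * K₁ * |κ| ^ L * J * (1 + t) ^ L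
    + K₀ * t + |W| * C₂ * dataNorm g p t * (1 + t) ^ p, by positivity, ?_⟩
  intro t₀ h ε N P m s x Y ht₀ ht₀t hh hκ hN hx hxt hε hW hs hsσ hsh hY
  have hT : 0 < t - t₀ := sub_pos.2 ht₀t
  -- Since `t₀ < t`, at least one step is taken; `h ≤ t` then lets every power of `h` be lowered to
  -- the common exponent at the cost of a constant.
  have hht : h ≤ t := by
    have hN1 : (1 : ℝ) ≤ N := by
      have : N ≠ 0 := by rintro rfl; simp at hN; linarith
      exact_mod_cast Nat.one_le_iff_ne_zero.2 this
    nlinarith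
  have hε0 : 0 ≤ ε := (norm_nonneg _).trans (hε t ⟨ht₀t, le_rfl⟩)
  have hκ' : t₀ ≤ |κ| * h := hκ.trans (by gcongr; exact le_abs_self κ)
  have hsubT : Set.Icc 0 (t - t₀) ⊆ Set.Icc 0 t := Set.Icc_subset_Icc le_rfl (by linarith)
  have hsing := singular_error (G := interp x g) hα ht₀ ht₀t.le hfi hg.continuousOn hK₀
    (hC₁ t₀ ht₀ ht₀t.le) (δ := 2 * (K₁ * t₀ ^ L)) (by positivity) (fun y hy => by
      have := interp_error ht (Set.Icc_subset_Icc hT.le le_rfl) hLγ hg hK₁ hx hxt hy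
      rwa [sub_sub_cancel] at this)
  have hreg := regular_error (δ := C₂ * h ^ p * dataNorm g p t) (N := N) (Y := Y) ht₀ ht₀t hfi
    hg.continuousOn hK₀ hε (hW.trans (le_abs_self W)) hs (by positivity) (fun ℓ =>
      (hC₂ (t - t₀) γ g (s ℓ) h N (Y ℓ) hT (by linarith) hpγ (hg.mono hsubT) (hs ℓ) (hsσ ℓ) hh hN
        (hsh ℓ) (hY ℓ)).trans (by
          gcongr
          exact dataNorm_mono hT (by linarith) hpγ hg))
  rw [convInt_eq_add ht₀ ht₀t.le hfi hg.continuousOn, add_sub_add_comm]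
  refine (norm_add_le _ _).trans ((add_le_add hsing hreg).trans ?_)
  set r := min (M + 1) (min L p) with hr
  have hM : t₀ ^ (M + 1) ≤ |κ| ^ (M + 1) * ((1 + t) ^ (M + 1) * h ^ r) :=
    (pow_le_pow_left₀ ht₀ hκ' _).trans (by
      rw [mul_pow]
      gcongr
      exact pow_le_one_add_pow_mul_pow hh.le hht (by omega))
  have hLp : t₀ ^ L ≤ |κ| ^ L * ((1 + t) ^ L * h ^ r) :=
    (pow_le_pow_left₀ ht₀ hκ' _).trans (by
      rw [mul_pow]
      gcongr
      exact pow_le_one_add_pow_mul_pow hh.le hht (by omega))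
  have hpp : h ^ p ≤ (1 + t) ^ p * h ^ r :=
    pow_le_one_add_pow_mul_pow hh.le hht (by omega)
  have hr0 : 0 ≤ h ^ r := by positivity
  calc K₀ * (C₁ * t₀ ^ (M + 1)) + 2 * (K₁ * t₀ ^ L) * J
        + (ε * K₀ * t + |W| * (C₂ * h ^ p * dataNorm g p t))
      ≤ K₀ * (C₁ * (|κ| ^ (M + 1) * ((1 + t) ^ (M + 1) * h ^ r)))
        + 2 * (K₁ * (|κ| ^ L * ((1 + t) ^ L * h ^ r))) * J
        + (ε * K₀ * t + |W| * (C₂ * ((1 + t) ^ p * h ^ r) * dataNorm g p t)) := by gcongr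
    _ = (K₀ * C₁ * |κ| ^ (M + 1) * (1 + t) ^ (M + 1) + 2 * K₁ * |κ| ^ L * J * (1 + t) ^ L
        + |W| * C₂ * dataNorm g p t * (1 + t) ^ p) * h ^ r + K₀ * t * ε := by ring
    _ ≤ (K₀ * C₁ * |κ| ^ (M + 1) * (1 + t) ^ (M + 1) + 2 * K₁ * |κ| ^ L * J * (1 + t) ^ L
        + |W| * C₂ * dataNorm g p t * (1 + t) ^ p) * (h ^ r + ε) + K₀ * t * (h ^ r + ε) := by
        gcongr <;> linarith
    _ = _ := by ring
theorem mainTheorem3 {S : ℕ} (R : RKTableau S) (p q : ℕ)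
    (horder : R.HasOrder p) (hstage : R.HasStageOrder q) (hqp : q + 1 ≤ p)
    (hL : R.LStable) (heig : R.EigenvaluesPos) (hc : ∀ i, R.c i ∈ Set.Icc (0 : ℝ) 1) :
    -- every step of the implicit scheme is uniquely solvable
    (∀ (s : ℂ) (g : ℝ → ℂ) (τ h : ℝ) (u : ℂ), 0 ≤ s.re → 0 < h →
      ∃! u₁ : ℂ, R.IsStep (fun τ u => -s * u + g τ) τ h u u₁) ∧
    -- the Runge–Kutta error
    (∀ t σ : ℝ, 0 < t → ∃ C : ℝ, 0 ≤ C ∧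
      ∀ (t₀ : ℝ), 0 ≤ t₀ → t₀ < t →
      ∀ (γ : ℕ) (g : ℝ → ℂ), p ≤ γ → ContDiffOn ℝ γ g (Set.Icc 0 (t - t₀)) →
      ∀ (P : ℕ) (s : Fin P → ℂ) (h : ℝ) (N : ℕ) (Y : Fin P → ℕ → ℂ),
        (∀ ℓ, 0 ≤ (s ℓ).re) → (∀ ℓ, ‖s ℓ‖ ≤ σ) →
        0 < h → N * h = t - t₀ → (∀ ℓ, ‖s ℓ * h‖ ≤ 1) →
        (∀ ℓ, R.IsSolution (s ℓ) g h N (Y ℓ)) →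
        maxRKError s g (t - t₀) N Y ≤ C * h ^ p * dataNorm g p (t - t₀)) ∧
    -- the error of the convolution quadrature
    (∀ (t : ℝ) (f g : ℝ → ℂ) (a : ℕ → ℂ) (α : ℝ) (γ L M : ℕ) (κ σ W : ℝ), 0 < t →
      IntervalIntegrable f MeasureTheory.volume 0 t →
      0 ≤ α → α < 1 → HasGenTaylor f a α →
      p ≤ γ → L ≤ γ → ContDiffOn ℝ γ g (Set.Icc 0 t) →
      ∃ C : ℝ, 0 ≤ C ∧
      ∀ (t₀ h ε : ℝ) (N P : ℕ) (m s : Fin P → ℂ) (x : Fin L → ℝ) (Y : Fin P → ℕ → ℂ),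
        0 ≤ t₀ → t₀ < t → 0 < h → t₀ ≤ κ * h → N * h = t - t₀ →
        Function.Injective x → (∀ i, x i ∈ Set.Icc (t - t₀) t) →
        (∀ y ∈ Set.Ioc t₀ t, ‖f y - soe m s y‖ ≤ ε) → ∑ ℓ, ‖m ℓ‖ ≤ W →
        (∀ ℓ, 0 ≤ (s ℓ).re) → (∀ ℓ, ‖s ℓ‖ ≤ σ) → (∀ ℓ, ‖s ℓ * h‖ ≤ 1) →
        (∀ ℓ, R.IsSolution (s ℓ) g h N (Y ℓ)) →
        ‖convInt f g t
            - (singularApprox a α M (interp x g) t t₀ + regularApprox m s t₀ N Y)‖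
          ≤ C * (h ^ min (M + 1) (min L p) + ε)) := by
  refine ⟨?_, ?_, ?_⟩
  · intro s g τ h u hs hh
    have hz : (-s * h).re ≤ 0 := by
      rw [Complex.re_mul_ofReal, Complex.neg_re]
      nlinarith
    exact ⟨_, (heig.isStep_iff hz).2 rfl, fun _ h => (heig.isStep_iff hz).1 h⟩
  · intro t σ ht
    obtain ⟨C, hC0, hC⟩ := horder.exists_error_bound (by omega) hL heig hc ht σ
    refine ⟨C, hC0, ?_⟩
    intro t₀ ht₀ ht₀t γ g hpγ hg P s h N Y hs hsσ hh hN hsh hY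
    have := dataNorm_nonneg g p (t - t₀)
    -- Nonnegativity of the bound covers `P = 0`, where the supremum is `0`.
    exact Real.iSup_le (fun ℓ => hC (t - t₀) γ g (s ℓ) h N (Y ℓ) (by linarith) (by linarith) hpγ
      hg (hs ℓ) (hsσ ℓ) hh hN (hsh ℓ) (hY ℓ)) (by positivity)
  · intro t f g a α γ L M κ σ W ht hfi _ hα hf hpγ hLγ hg
    exact horder.exists_quadrature_bound (by omega) hL heig hc M κ σ W ht hfi hα hf hpγ hLγ hg
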